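/- Let $K$ be an infinite field. Let $A$ be a finite-dimensional associative unital $K$-algebra with $K$-basis $u_1,\dots,u_n$, let $K(\xi)=K(\xi_1,\dots,\xi_n)$ be the rational function field, and let $$m_{a(\xi)}(\lambda)=\lambda^m+c_1(\xi)\lambda^{m-1}+\dots+c_m(\xi)$$ be the minimal polynomial over $K(\xi)$ of the general element $a(\xi)=\sum_i\xi_i u_i\in A\otimes_K K(\xi)$. Its coefficients lie in $K[\xi_1,\dots,\xi_n]$. Its degree $m$ is called the (reduced) degree of $A$ over $K$, and the reduced norm $\bar n:A\to K$ is the polynomial function $\bar n(b)=(-1)^m c_m(b_1,\dots,b_n)$ for $b=\sum_i b_iu_i$ with $b_i\in K$. A character on $A$ is a function $\chi:A\to K$ that is polynomial in the coordinates with respect to a $K$-basis of $A$ and satisfies $\chi(1)=1$ and $\chi(ab)=\chi(a)\chi(b)$ for all $a,b\in A$. Theorem 6.2.1. Let $D$ be a finite-dimensional division algebra over $K$, let $C$ be its center, and suppose that $D$ has reduced degree $d$ over $C$ and that $C$ has reduced degree $c$ over $K$. Then for every integer $k\ge 1$: (a) the matrix algebra $M_k(D)$ has reduced degree $dkc$ over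 $K$; (b) for every character $\chi:M_k(D)\to K$ there is an integer $t\ge 0$ such that $\chi(a)=\bar n(a)^t$ for all $a\in M_k(D)$, where $\bar n$ is the reduced norm of $M_k(D)$ over $K$. -/

import Mathlib

open scoped TensorProduct

noncomputable section

namespace ReducedNorm

variable (K : Type*) [Field K] (A : Type*) [Ring A] [Algebra K A] [FiniteDimensional K A]

/-- The index set `{1, …, n}`, `n = dim_K A`, of the coordinates on `A`. -/
abbrev Idx : Type := Fin (Module.finrank K A)

/-- A vector space basis `u₁, …, uₙ` of `A` over `K`. -/
def basis : Module.Basis (Idx K A) K A := Module.finBasis K A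

/-- The polynomial ring `K[ξ] = K[ξ₁, …, ξₙ]`. -/
abbrev PolyRing : Type _ := MvPolynomial (Idx K A) K

/-- The rational function field `K(ξ) = K(ξ₁, …, ξₙ)`. -/
abbrev RatField : Type _ := FractionRing (PolyRing K A)

/-- The general element `a(ξ) = ∑ ξᵢ uᵢ` of `K(ξ) ⊗_K A`. -/
def generalElement : RatField K A ⊗[K] A :=
  ∑ i, (algebraMap (PolyRing K A) (RatField K A) (MvPolynomial.X i)) ⊗ₜ[K] (basis K A i)

/-- The minimal polynomial of the general element over `K(ξ)`. -/
def generalMinpoly : Polynomial (RatField K A) :=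
  minpoly (RatField K A) (generalElement K A)

/-- The (reduced) degree of `A` over `K`: the degree of the minimal polynomial of the general
element. -/
def reducedDegree : ℕ := (generalMinpoly K A).natDegree

/-- The minimal polynomial of the general element has its coefficients in `K[ξ]`. -/
theorem exists_map_eq_generalMinpoly :
    ∃ P : Polynomial (PolyRing K A),
      P.map (algebraMap (PolyRing K A) (RatField K A)) = generalMinpoly K A := by
  let y : PolyRing K A ⊗[K] A := ∑ i, (MvPolynomial.X i : PolyRing K A) ⊗ₜ[K] (basis K A i)
  let f : PolyRing K A ⊗[K] A →ₐ[PolyRing K A] RatField K A ⊗[K] A :=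
    Algebra.TensorProduct.map (Algebra.ofId (PolyRing K A) (RatField K A)) (AlgHom.id K A)
  have hf : f y = generalElement K A := by
    simp [f, y, generalElement, map_sum, Algebra.ofId_apply]
  obtain ⟨p, hp, hpy⟩ : IsIntegral (PolyRing K A) y := IsIntegral.of_finite _ y
  have hdvd : generalMinpoly K A ∣ p.map (algebraMap (PolyRing K A) (RatField K A)) := by
    apply minpoly.dvd
    rw [Polynomial.aeval_map_algebraMap, ← hf, Polynomial.aeval_algHom_apply,
      Polynomial.aeval_def, hpy, map_zero]
  have hmonic : (generalMinpoly K A).Monic := minpoly.monic (IsIntegral.of_finite _ _)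
  obtain ⟨P, hP⟩ := IsIntegrallyClosed.eq_map_mul_C_of_dvd (RatField K A) hp hdvd
  exact ⟨P, by simpa [hmonic.leadingCoeff] using hP⟩

/-- The minimal polynomial `λᵐ + c₁(ξ) λᵐ⁻¹ + ⋯ + cₘ(ξ)` of the general element, with its
coefficients regarded as elements of `K[ξ]`. -/
def generalCharpoly : Polynomial (PolyRing K A) :=
  (exists_map_eq_generalMinpoly K A).choose

theorem map_generalCharpoly :
    (generalCharpoly K A).map (algebraMap (PolyRing K A) (RatField K A)) = generalMinpoly K A :=
  (exists_map_eq_generalMinpoly K A).choose_spec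

variable {A}

/-- The coordinates of `b ∈ A` in the basis `u₁, …, uₙ`. -/
def coords (b : A) : Idx K A → K := fun i => (basis K A).repr b i

/-- The reduced characteristic polynomial of `b = ∑ bᵢ uᵢ`, obtained from the minimal polynomial
of the general element by specializing `ξᵢ` to `bᵢ`. -/
def reducedCharpoly (b : A) : Polynomial K :=
  (generalCharpoly K A).map (MvPolynomial.eval (coords K b))

/-- The reduced norm `(-1)ᵐ cₘ(b)` of `b`, where `m` is the degree of `A` over `K`. -/
def reducedNorm (b : A) : K :=
  (-1) ^ reducedDegree K A * (reducedCharpoly K b).coeff 0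

variable {K}

/-- A function `A → K` is polynomial if it is given by a polynomial in the coordinates. -/
def IsPolynomialFunction (χ : A → K) : Prop :=
  ∃ p : PolyRing K A, ∀ a : A, χ a = MvPolynomial.eval (coords K a) p

/-- A character on `A`: a polynomial function `A → K` that is multiplicative and takes `1`
to `1`. -/
structure IsCharacter (χ : A → K) : Prop where
  polynomial : IsPolynomialFunction χ
  map_one : χ 1 = 1
  map_mul : ∀ a b : A, χ (a * b) = χ a * χ b

end ReducedNorm

end

noncomputable section

namespace ReducedNorm

open Polynomial

/-! For (a), let `L` be an algebraic closure of `C`. Since `D` is central over `C`, `L ⊗ D` is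
simple, hence some `M_r(L)`, and `r = d`. Cayley–Hamilton in `M_{kr}(L)` bounds the degree of
`M_k(D)` over `C` by `kd`, and taking norms from `C[X]` to `K[X]` bounds the degree over `K` by
`dkc`. The bound is attained: `D` has an element separable of degree `d` over `C`, a primitive
element theorem combines it with an element of `C` of degree `c` over `K` into some nonzero `w` of
degree `dc` over `K`, and the companion matrix that is a `k`-th root of `w` has degree `kdc`.

For (b), the point is that the norm polynomial is irreducible. With `q` the minimal polynomial of
`w` and `e` its degree, the norm on the plane `t·1 - companion k (s • w)` is `s^e q(t^k / s)`;
putting `t = 1` gives the reverse of `q`, which is irreducible. A degree count lifts irreducibility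
from the plane to the whole algebra (`irreducible_normPoly_matrix`). Applying a character to `a ·
adj a = n(a)` shows that its polynomial divides a power of the norm, so it is a power of the norm up
to a constant, and the value at `1` makes the constant `1` (`exists_eq_reducedNorm_pow`). -/

theorem eq_minpoly_of_natDegree_le {K B : Type*} [Field K] [Ring B] [Algebra K B] {x : B}
    {p : K[X]} (hp : p.Monic) (hx : aeval x p = 0)
    (hdeg : p.natDegree ≤ (minpoly K x).natDegree) : p = minpoly K x := by
  have hint : IsIntegral K x := ⟨p, hp, hx⟩
  exact Polynomial.eq_of_monic_of_dvd_of_natDegree_le (minpoly.monic hint) hp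
    (minpoly.dvd K x hx) hdeg |>.symm ▸ rfl

theorem le_natDegree_minpoly {K B : Type*} [Field K] [Ring B] [Algebra K B] {x : B}
    (hint : IsIntegral K x) {m : ℕ}
    (h : LinearIndependent K fun i : Fin m => x ^ (i : ℕ)) : m ≤ (minpoly K x).natDegree := by
  by_contra! hlt
  have h0 := minpoly.aeval K x
  rw [aeval_eq_sum_range' hlt, Finset.sum_range] at h0
  have := Fintype.linearIndependent_iff.1 h (fun i => (minpoly K x).coeff i) h0
    ⟨_, hlt⟩
  have hm := minpoly.monic hint
  rw [Polynomial.Monic, Polynomial.leadingCoeff] at hm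
  exact one_ne_zero (hm.symm.trans this)

section

variable (K : Type*) [Field K] (A : Type*) [Ring A] [Algebra K A] [FiniteDimensional K A]

theorem generalMinpoly_monic : (generalMinpoly K A).Monic :=
  minpoly.monic (IsIntegral.of_finite _ _)

theorem generalCharpoly_monic : (generalCharpoly K A).Monic := by
  have h := generalMinpoly_monic K A
  rw [← map_generalCharpoly] at h
  exact Polynomial.monic_of_injective (IsFractionRing.injective _ _) h

theorem natDegree_generalCharpoly : (generalCharpoly K A).natDegree = reducedDegree K A := by
  rw [reducedDegree, ← map_generalCharpoly, (generalCharpoly_monic K A).natDegree_map]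

/-- The general element with coefficients in the polynomial ring. -/
def genericElement : PolyRing K A ⊗[K] A :=
  ∑ i, (MvPolynomial.X i : PolyRing K A) ⊗ₜ[K] (basis K A i)

/-- Extension of scalars from the polynomial ring to the rational function field. -/
def toRatField : PolyRing K A ⊗[K] A →ₐ[PolyRing K A] RatField K A ⊗[K] A :=
  Algebra.TensorProduct.map (Algebra.ofId (PolyRing K A) (RatField K A)) (AlgHom.id K A)

omit [FiniteDimensional K A] in
theorem toRatField_injective : Function.Injective (toRatField K A) := by
  have h := Module.Flat.rTensor_preserves_injective_linearMap (M := A)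
    ((IsScalarTower.toAlgHom K (PolyRing K A) (RatField K A)).toLinearMap)
    (IsFractionRing.injective (PolyRing K A) (RatField K A))
  have heq : ∀ x, toRatField K A x = LinearMap.rTensor A
      ((IsScalarTower.toAlgHom K (PolyRing K A) (RatField K A)).toLinearMap) x := by
    intro x
    induction x with
    | zero => simp
    | tmul x y => rfl
    | add x y hx hy => simp [hx, hy]
  intro x y hxy
  exact h (by rw [← heq, ← heq, hxy])

theorem toRatField_genericElement : toRatField K A (genericElement K A) = generalElement K A := by
  simp [toRatField, genericElement, generalElement, map_sum, Algebra.ofId_apply]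

theorem aeval_genericElement : aeval (genericElement K A) (generalCharpoly K A) = 0 := by
  apply toRatField_injective
  rw [← Polynomial.aeval_algHom_apply, toRatField_genericElement, map_zero,
    ← Polynomial.aeval_map_algebraMap (RatField K A), map_generalCharpoly]
  exact minpoly.aeval _ _

end

/-! ### Specializing the generic element; elements of maximal degree. -/

section

variable {K : Type*} [Field K] {A : Type*} [Ring A] [Algebra K A] [FiniteDimensional K A]
variable {L : Type*} [CommRing L] [Algebra K L] {B : Type*} [Ring B] [Algebra K B] [Algebra L B]
  [IsScalarTower K L B]

/-- Specialization of the indeterminates to elements of a commutative algebra `L`, along an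
algebra homomorphism from `A` to an `L`-algebra. -/
def specialize (φ : A →ₐ[K] B) (y : Idx K A → L) : PolyRing K A ⊗[K] A →ₐ[K] B :=
  Algebra.TensorProduct.lift ((IsScalarTower.toAlgHom K L B).comp (MvPolynomial.aeval y)) φ
    (fun _ _ => Algebra.commutes _ _)

omit [FiniteDimensional K A] in
theorem specialize_tmul (φ : A →ₐ[K] B) (y : Idx K A → L) (p : PolyRing K A) (a : A) :
    specialize φ y (p ⊗ₜ a) = MvPolynomial.aeval y p • φ a := by
  rw [Algebra.smul_def]
  exact Algebra.TensorProduct.lift_tmul _ _ _ _ _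

theorem specialize_genericElement (φ : A →ₐ[K] B) (y : Idx K A → L) :
    specialize φ y (genericElement K A) = ∑ i, y i • φ (basis K A i) := by
  simp [genericElement, specialize_tmul]

/-- Cayley–Hamilton for the generic element survives any specialization of the indeterminates. It is
needed for `L = K`, for `L = K[X]` and for extension fields. -/
theorem aeval_specialize (φ : A →ₐ[K] B) (y : Idx K A → L) :
    aeval (∑ i, y i • φ (basis K A i))
      ((generalCharpoly K A).map (MvPolynomial.aeval y : PolyRing K A →ₐ[K] L).toRingHom) = 0 := by
  have h := congrArg (specialize φ y) (aeval_genericElement K A)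
  rw [map_zero, aeval_def, ← AlgHom.coe_toRingHom, hom_eval₂] at h
  rw [aeval_def, eval₂_map, ← specialize_genericElement, ← h]
  congr 1
  refine RingHom.ext fun p => ?_
  have := specialize_tmul φ y p 1
  rw [map_one, Algebra.smul_def, mul_one] at this
  exact this.symm

omit [Algebra K L] in
theorem natDegree_map_generalCharpoly [Nontrivial L] (f : PolyRing K A →+* L) :
    ((generalCharpoly K A).map f).natDegree = reducedDegree K A := by
  rw [(generalCharpoly_monic K A).natDegree_map, natDegree_generalCharpoly]

theorem sum_coords_smul (b : A) : ∑ i, coords K b i • basis K A i = b :=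
  (basis K A).sum_repr b

theorem aeval_reducedCharpoly (b : A) : aeval b (reducedCharpoly K b) = 0 := by
  have h := aeval_specialize (AlgHom.id K A) (coords K b)
  simp only [AlgHom.id_apply, sum_coords_smul] at h
  rw [← h, reducedCharpoly]
  congr 2

theorem reducedCharpoly_monic (b : A) : (reducedCharpoly K b).Monic :=
  (generalCharpoly_monic K A).map _

theorem natDegree_reducedCharpoly (b : A) : (reducedCharpoly K b).natDegree = reducedDegree K A :=
  natDegree_map_generalCharpoly _

theorem natDegree_minpoly_le (b : A) : (minpoly K b).natDegree ≤ reducedDegree K A := by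
  rw [← natDegree_reducedCharpoly b]
  exact natDegree_le_of_dvd (minpoly.dvd K b (aeval_reducedCharpoly b))
    (reducedCharpoly_monic b).ne_zero

theorem reducedCharpoly_eq_minpoly {b : A} (hb : (minpoly K b).natDegree = reducedDegree K A) :
    reducedCharpoly K b = minpoly K b :=
  eq_minpoly_of_natDegree_le (reducedCharpoly_monic b) (aeval_reducedCharpoly b)
    (by rw [natDegree_reducedCharpoly, hb])

/-- The coordinates, in the polynomial ring, of an element of `K[ξ] ⊗ A`. -/
def polyCoords (z : PolyRing K A ⊗[K] A) (i : Idx K A) : PolyRing K A :=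
  (Algebra.TensorProduct.basis (PolyRing K A) (basis K A)).repr z i

theorem specialize_eq_sum (φ : A →ₐ[K] B) (y : Idx K A → L) (z : PolyRing K A ⊗[K] A) :
    specialize φ y z = ∑ i, MvPolynomial.aeval y (polyCoords z i) • φ (basis K A i) := by
  conv_lhs => rw [← (Algebra.TensorProduct.basis (PolyRing K A) (basis K A)).sum_repr z]
  rw [map_sum]
  refine Finset.sum_congr rfl fun i _ => ?_
  rw [Algebra.TensorProduct.basis_apply, TensorProduct.smul_tmul', smul_eq_mul, mul_one,
    specialize_tmul]
  rfl

/-- The first `m` powers of the general element are independent over `K(ξ)`, so their coordinate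
matrix has a left inverse. Clearing denominators by `Δ` gives an identity over `K[ξ]`, which can be
specialized at `b`; if `Δ(b) ≠ 0`, the powers of `b` are independent too. -/
theorem exists_polynomial_natDegree_minpoly :
    ∃ Δ : PolyRing K A, Δ ≠ 0 ∧ ∀ b : A, MvPolynomial.eval (coords K b) Δ ≠ 0 →
      (minpoly K b).natDegree = reducedDegree K A := by
  set m := reducedDegree K A with hm
  let R := PolyRing K A
  let F := RatField K A
  let bF := Algebra.TensorProduct.basis F (basis K A)
  have hli : LinearIndependent F fun j : Fin m => (generalElement K A) ^ (j : ℕ) :=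
    linearIndependent_pow _
  obtain ⟨g, hg⟩ := LinearMap.exists_leftInverse_of_injective
    (Fintype.linearCombination F fun j : Fin m => (generalElement K A) ^ (j : ℕ))
    (LinearMap.ker_eq_bot.2 (LinearIndependent.fintypeLinearCombination_injective hli))
  obtain ⟨δ, hδ⟩ := IsLocalization.exist_integer_multiples_of_finite (nonZeroDivisors R)
    (fun ij : Idx K A × Fin m => g (bF ij.1) ij.2)
  choose B hB using fun ij => hδ ij
  have hcoord : ∀ (z : R ⊗[K] A) (j : Fin m),
      algebraMap R F (∑ i, B (i, j) * polyCoords z i) = algebraMap R F δ *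
        g (toRatField K A z) j := by
    intro z j
    have hz : toRatField K A z = ∑ i, algebraMap R F (polyCoords z i) • bF i := by
      conv_lhs => rw [← (Algebra.TensorProduct.basis R (basis K A)).sum_repr z]
      rw [map_sum]
      refine Finset.sum_congr rfl fun i _ => ?_
      rw [map_smul, Algebra.TensorProduct.basis_apply]
      simp only [bF, Algebra.TensorProduct.basis_apply, toRatField, Algebra.TensorProduct.map_tmul,
        map_one, AlgHom.id_apply, algebraMap_smul]
      rfl
    rw [hz, map_sum, map_sum, Finset.sum_apply, Finset.mul_sum]
    refine Finset.sum_congr rfl fun i _ => ?_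
    rw [map_mul, hB, map_smul, Pi.smul_apply, smul_eq_mul]
    simp only [Algebra.smul_def]
    ring
  -- The left-inverse identity multiplied by `δ`: both sides now lie in `K[ξ]`.
  have hpow : ∀ j j' : Fin m, ∑ i, B (i, j) * polyCoords ((genericElement K A) ^ (j' : ℕ)) i =
      if j = j' then (δ : R) else 0 := by
    intro j j'
    apply IsFractionRing.injective R F
    rw [hcoord, map_pow, toRatField_genericElement]
    have := congrFun (LinearMap.congr_fun hg (Pi.single j' 1)) j
    simp only [LinearMap.comp_apply, LinearMap.id_apply] at this
    rw [Fintype.linearCombination_apply_single, one_smul] at this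
    rw [this, Pi.single_apply]
    split_ifs <;> simp
  refine ⟨δ, nonZeroDivisors.coe_ne_zero δ, fun b hb => le_antisymm (natDegree_minpoly_le b) ?_⟩
  apply le_natDegree_minpoly (IsIntegral.of_finite K b)
  rw [Fintype.linearIndependent_iff]
  intro c hc j
  have hb' : ∀ n : ℕ, ∀ i, coords K (b ^ n) i =
      MvPolynomial.eval (coords K b) (polyCoords (genericElement K A ^ n) i) := by
    intro n i
    have h1 := specialize_eq_sum (AlgHom.id K A) (coords K b) (genericElement K A ^ n)
    rw [map_pow, specialize_genericElement] at h1
    simp only [AlgHom.id_apply, sum_coords_smul] at h1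
    rw [h1, coords, Module.Basis.repr_sum_self]
    rfl
  have hsum : ∀ i, ∑ j' : Fin m, c j' * coords K (b ^ (j' : ℕ)) i = 0 := by
    intro i
    have := congrArg (fun x => coords K x i) hc
    simpa [coords] using this
  have : MvPolynomial.eval (coords K b) (δ : R) * c j = 0 := by
    calc _ = ∑ j' : Fin m, c j' * MvPolynomial.eval (coords K b) (if j = j' then (δ : R) else 0) := by
          simp [apply_ite, mul_comm]
      _ = ∑ j' : Fin m, ∑ i, MvPolynomial.eval (coords K b) (B (i, j)) *
            (c j' * coords K (b ^ (j' : ℕ)) i) := by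
          refine Finset.sum_congr rfl fun j' _ => ?_
          rw [← hpow, map_sum, Finset.mul_sum]
          refine Finset.sum_congr rfl fun i _ => ?_
          rw [map_mul, hb']; ring
      _ = 0 := by
          rw [Finset.sum_comm]
          refine Finset.sum_eq_zero fun i _ => ?_
          rw [← Finset.mul_sum, hsum, mul_zero]
  exact (mul_eq_zero.1 this).resolve_left hb

theorem coords_sum (y : Idx K A → K) : coords K (∑ i, y i • basis K A i) = y := by
  ext i
  rw [coords, Module.Basis.repr_sum_self]

theorem coords_add (a b : A) : coords K (a + b) = coords K a + coords K b := by
  ext i; simp [coords]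

theorem coords_smul (s : K) (b : A) : coords K (s • b) = s • coords K b := by
  ext i; simp [coords]

theorem coords_sub (a b : A) : coords K (a - b) = coords K a - coords K b := by
  ext i; simp [coords]

variable [Infinite K]

theorem exists_eval_coords_ne_zero {p : PolyRing K A} (hp : p ≠ 0) :
    ∃ b : A, MvPolynomial.eval (coords K b) p ≠ 0 := by
  by_contra! h
  refine hp (MvPolynomial.funext fun y => ?_)
  rw [map_zero, ← coords_sum y]
  exact h _

variable (K A) in
theorem exists_natDegree_minpoly_eq : ∃ b : A, (minpoly K b).natDegree = reducedDegree K A := by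
  obtain ⟨Δ, h0, hΔ⟩ := exists_polynomial_natDegree_minpoly (K := K) (A := A)
  obtain ⟨b, hb⟩ := exists_eval_coords_ne_zero h0
  exact ⟨b, hΔ b hb⟩

/-- Elements of maximal degree are Zariski dense. Polynomial identities for the norm thus need
checking only where the reduced characteristic polynomial is the minimal polynomial. -/
theorem eq_of_eval_coords_eq {p q : PolyRing K A} (h : ∀ b : A,
    (minpoly K b).natDegree = reducedDegree K A →
      MvPolynomial.eval (coords K b) p = MvPolynomial.eval (coords K b) q) : p = q := by
  obtain ⟨Δ, h0, hΔ⟩ := exists_polynomial_natDegree_minpoly (K := K) (A := A)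
  by_contra hpq
  obtain ⟨b, hb⟩ := exists_eval_coords_ne_zero (mul_ne_zero h0 (sub_ne_zero.2 hpq))
  rw [map_mul, map_sub] at hb
  exact right_ne_zero_of_mul hb (sub_eq_zero.2 (h b (hΔ b (left_ne_zero_of_mul hb))))

end

/-! ### Polynomial identities and homogeneity over an infinite field. -/

theorem infinite_ne_zero (K : Type*) [Field K] [Infinite K] : {s : K | s ≠ 0}.Infinite :=
  (Set.finite_singleton (0 : K)).infinite_compl

theorem eq_of_eval_eq_of_ne_zero {K : Type*} [Field K] [Infinite K] {p q : K[X]}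
    (h : ∀ s : K, s ≠ 0 → p.eval s = q.eval s) : p = q :=
  Polynomial.eq_of_infinite_eval_eq p q ((infinite_ne_zero K).mono fun s hs => h s hs)

theorem map_aeval_eq_eval {σ K S : Type*} [Field K] [CommRing S] [Algebra K S] (ψ : S →+* K)
    (hψ : ∀ c : K, ψ (algebraMap K S c) = c) (f : σ → S) (p : MvPolynomial σ K) :
    ψ (MvPolynomial.aeval f p) = MvPolynomial.eval (fun i => ψ (f i)) p := by
  rw [MvPolynomial.aeval_def, ← MvPolynomial.coe_eval₂Hom, ← RingHom.comp_apply,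
    MvPolynomial.comp_eval₂Hom, MvPolynomial.eval]
  congr 2
  exact RingHom.ext hψ

theorem eval_reverse {K : Type*} [Field K] {s : K} (hs : s ≠ 0) (p : K[X]) :
    p.reverse.eval s = s ^ p.natDegree * p.eval s⁻¹ := by
  let : Invertible s⁻¹ := invertibleOfNonzero (inv_ne_zero hs)
  have h := eval₂_reverse_mul_pow (RingHom.id K) s⁻¹ p
  rw [invOf_eq_inv, inv_inv, ← eval, ← eval] at h
  rw [← h, mul_comm, mul_assoc, ← mul_pow, inv_mul_cancel₀ hs, one_pow, mul_one]

theorem coeff_rescale {σ K : Type*} [Field K] (s : K) (p : MvPolynomial σ K) (d : σ →₀ ℕ) :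
    MvPolynomial.coeff d (MvPolynomial.aeval (fun i => MvPolynomial.C s * MvPolynomial.X i) p) =
      s ^ d.degree * MvPolynomial.coeff d p := by
  classical
  induction p using MvPolynomial.induction_on' with
  | monomial u a =>
    have : MvPolynomial.aeval (fun i : σ => (MvPolynomial.C s * MvPolynomial.X i :
        MvPolynomial σ K)) (MvPolynomial.monomial u a) =
        MvPolynomial.monomial u (s ^ u.degree * a) := by
      rw [MvPolynomial.aeval_monomial, MvPolynomial.monomial_eq, Finsupp.prod, Finsupp.prod]
      simp only [mul_pow, Finset.prod_mul_distrib, Finset.prod_pow_eq_pow_sum,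
        Finsupp.degree_apply, map_mul, map_pow, MvPolynomial.algebraMap_eq]
      ring
    rw [this, MvPolynomial.coeff_monomial, MvPolynomial.coeff_monomial]
    split_ifs with h
    · rw [h]
    · simp
  | add p q hp hq => rw [map_add, MvPolynomial.coeff_add, hp, hq, MvPolynomial.coeff_add, mul_add]

/-- Comparing coefficients at a monomial of degree `e` that occurs in `p` gives `s ^ e = s ^ m` for
all `s ≠ 0`, so `e = m` because `K` is infinite. -/
theorem isHomogeneous_of_eval_smul {σ K : Type*} [Field K] [Infinite K] {p : MvPolynomial σ K}
    {m : ℕ} (h : ∀ s : K, s ≠ 0 → ∀ y : σ → K,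
      MvPolynomial.eval (s • y) p = s ^ m * MvPolynomial.eval y p) : p.IsHomogeneous m := by
  intro d hd
  rw [Pi.one_def, ← Finsupp.degree_eq_weight_one]
  have key : (X ^ d.degree : K[X]) = X ^ m := by
    refine eq_of_eval_eq_of_ne_zero fun s hs => ?_
    have h1 : MvPolynomial.aeval (fun i => MvPolynomial.C s * MvPolynomial.X i) p =
        MvPolynomial.C (s ^ m) * p := by
      refine MvPolynomial.funext fun y => ?_
      rw [map_mul, MvPolynomial.eval_C, ← h s hs y, map_aeval_eq_eval _ (by simp)]
      simp [Pi.smul_def]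
    have h2 := coeff_rescale s p d
    rw [h1, MvPolynomial.coeff_C_mul] at h2
    simpa using (mul_right_cancel₀ hd h2).symm
  simpa using congrArg natDegree key

/-! ### The reduced norm, its homogeneity, and characters. -/

section

variable {K : Type*} [Field K] {A : Type*} [Ring A] [Algebra K A] [FiniteDimensional K A]

variable (K A) in
/-- The reduced norm as a polynomial in the coordinates. -/
def normPoly : PolyRing K A := (-1) ^ reducedDegree K A * (generalCharpoly K A).coeff 0

theorem reducedNorm_eq_eval (b : A) :
    reducedNorm K b = MvPolynomial.eval (coords K b) (normPoly K A) := by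
  simp [reducedNorm, normPoly, reducedCharpoly]

omit [FiniteDimensional K A] in
/-- The image of a minimal polynomial under the affine change of variable `x ↦ t + s x`. -/
theorem aeval_affine_eq_zero (b : A) {s : K} (hs : s ≠ 0) (t : K) :
    aeval (algebraMap K A t + s • b) ((minpoly K b).comp (C s⁻¹ * (X - C t))) = 0 := by
  rw [aeval_comp]
  simp [Algebra.smul_def]
  rw [← mul_assoc, ← map_mul, inv_mul_cancel₀ hs, map_one, one_mul, minpoly.aeval]

theorem natDegree_affine {s : K} (hs : s ≠ 0) (t : K) :
    (C s⁻¹ * (X - C t) : K[X]).natDegree = 1 := by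
  rw [natDegree_C_mul (inv_ne_zero hs), natDegree_X_sub_C]

theorem natDegree_minpoly_affine_le (b : A) {s : K} (hs : s ≠ 0) (t : K) :
    (minpoly K (algebraMap K A t + s • b)).natDegree ≤ (minpoly K b).natDegree := by
  have h := natDegree_le_of_dvd (minpoly.dvd K _ (aeval_affine_eq_zero b hs t)) (by
    rw [Ne, comp_eq_zero_iff, not_or, not_and_or]
    refine ⟨minpoly.ne_zero (IsIntegral.of_finite K b), Or.inr fun h => ?_⟩
    have := natDegree_affine hs t
    rw [h, natDegree_C] at this
    exact zero_ne_one this)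
  rwa [natDegree_comp, natDegree_affine hs t, mul_one] at h

theorem natDegree_minpoly_affine (b : A) {s : K} (hs : s ≠ 0) (t : K) :
    (minpoly K (algebraMap K A t + s • b)).natDegree = (minpoly K b).natDegree := by
  refine le_antisymm (natDegree_minpoly_affine_le b hs t) ?_
  have h := natDegree_minpoly_affine_le (algebraMap K A t + s • b) (inv_ne_zero hs) (-(s⁻¹ * t))
  have hb : algebraMap K A (-(s⁻¹ * t)) + s⁻¹ • (algebraMap K A t + s • b) = b := by
    rw [smul_add, smul_smul, inv_mul_cancel₀ hs, one_smul, map_neg, map_mul, ← Algebra.smul_def]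
    abel
  rwa [hb] at h

/-- An invertible affine substitution keeps the degree maximal, so the norm of `t + s b` is still
read off a minimal polynomial. -/
theorem reducedNorm_affine {b : A} (hb : (minpoly K b).natDegree = reducedDegree K A)
    {s : K} (hs : s ≠ 0) (t : K) :
    reducedNorm K (algebraMap K A t + s • b) =
      (-s) ^ reducedDegree K A * (minpoly K b).eval (-(s⁻¹ * t)) := by
  set p := (minpoly K b).comp (C s⁻¹ * (X - C t)) with hp
  have hlead : p.leadingCoeff = s⁻¹ ^ reducedDegree K A := by
    rw [hp, leadingCoeff_comp (by rw [natDegree_affine hs t]; exact one_ne_zero), hb,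
      (minpoly.monic (IsIntegral.of_finite K b)).leadingCoeff, one_mul, leadingCoeff_mul,
      leadingCoeff_C, leadingCoeff_X_sub_C, mul_one]
  have hs' : s ^ reducedDegree K A ≠ 0 := pow_ne_zero _ hs
  have hmin : C (s ^ reducedDegree K A) * p = minpoly K (algebraMap K A t + s • b) := by
    apply eq_minpoly_of_natDegree_le
    · rw [Monic, leadingCoeff_mul, leadingCoeff_C, hlead, inv_pow, mul_inv_cancel₀ hs']
    · rw [map_mul, aeval_affine_eq_zero b hs t, mul_zero]
    · rw [natDegree_C_mul hs', natDegree_minpoly_affine b hs t, natDegree_comp,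
        natDegree_affine hs t, mul_one]
  rw [reducedNorm, reducedCharpoly_eq_minpoly (by rw [natDegree_minpoly_affine b hs t, hb]),
    ← hmin, coeff_zero_eq_eval_zero, eval_mul, eval_C, hp, eval_comp, neg_pow s]
  simp [mul_assoc]

theorem reducedNorm_sub {b : A} (hb : (minpoly K b).natDegree = reducedDegree K A) (t : K) :
    reducedNorm K (algebraMap K A t - b) = (minpoly K b).eval t := by
  have h := reducedNorm_affine hb (s := -1) (by simp) t
  simpa [sub_eq_add_neg, inv_neg] using h

/-- The identity `b * adj b = n(b)`. -/
theorem exists_adjoint_of_aeval_eq_zero {L B : Type*} [CommRing L] [Ring B] [Algebra L B] {x : B}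
    {p : L[X]} (h : aeval x p = 0) (e : ℕ) :
    x * ((-1) ^ (e + 1) * aeval x p.divX) = algebraMap L B ((-1) ^ e * p.coeff 0) := by
  have h1 := congrArg (aeval x) (X_mul_divX_add p)
  rw [h, map_add, map_mul, aeval_X, aeval_C] at h1
  have h2 := eq_neg_of_add_eq_zero_left h1
  rw [map_mul, map_pow, map_neg, map_one, pow_succ]
  rw [← mul_assoc, ((Commute.neg_one_right x).pow_right e |>.mul_right
    (Commute.neg_one_right x)).eq, mul_assoc, h2]
  simp

variable [Infinite K]

theorem reducedNorm_smul (b : A) {s : K} (hs : s ≠ 0) :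
    reducedNorm K (s • b) = s ^ reducedDegree K A * reducedNorm K b := by
  let r : PolyRing K A →ₐ[K] PolyRing K A :=
    MvPolynomial.aeval fun i => MvPolynomial.C s * MvPolynomial.X i
  have hr : ∀ (b : A) (p : PolyRing K A), MvPolynomial.eval (coords K b) (r p) =
      MvPolynomial.eval (coords K (s • b)) p := by
    intro b p
    simp only [r]
    rw [map_aeval_eq_eval _ (by simp), coords_smul]
    simp [Pi.smul_def]
  have h : r (normPoly K A) = MvPolynomial.C (s ^ reducedDegree K A) * normPoly K A := by
    refine eq_of_eval_coords_eq fun b hb => ?_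
    rw [hr, map_mul, MvPolynomial.eval_C, ← reducedNorm_eq_eval, ← reducedNorm_eq_eval]
    have h1 := reducedNorm_affine hb hs 0
    have h2 := reducedNorm_affine hb one_ne_zero 0
    simp only [map_zero, zero_add, one_smul, mul_zero, neg_zero] at h1 h2
    rw [h1, h2, neg_pow s, neg_pow 1]
    ring
  have := congrArg (MvPolynomial.eval (coords K b)) h
  rwa [hr, map_mul, MvPolynomial.eval_C, ← reducedNorm_eq_eval, ← reducedNorm_eq_eval] at this

variable (K A) in
theorem isHomogeneous_normPoly : (normPoly K A).IsHomogeneous (reducedDegree K A) := by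
  refine isHomogeneous_of_eval_smul fun s hs y => ?_
  have := reducedNorm_smul (∑ i, y i • basis K A i) hs
  rwa [reducedNorm_eq_eval, reducedNorm_eq_eval, coords_smul, coords_sum] at this

variable (K A) in
theorem totalDegree_normPoly_le : (normPoly K A).totalDegree ≤ reducedDegree K A :=
  (isHomogeneous_normPoly K A).totalDegree_le

omit [Infinite K] in
theorem eval_aeval_C_add_C_mul_X {σ : Type*} (p : MvPolynomial σ K) (y z : σ → K) (s : K) :
    (MvPolynomial.aeval (fun i => C (y i) + C (z i) * X) p).eval s =
      MvPolynomial.eval (y + s • z) p := by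
  rw [← coe_evalRingHom, map_aeval_eq_eval _ fun c => by
    rw [coe_evalRingHom, algebraMap_eq, eval_C]]
  congr 2
  ext i
  rw [coe_evalRingHom, eval_add, eval_mul, eval_C, eval_C, eval_X, Pi.add_apply, Pi.smul_apply,
    smul_eq_mul, mul_comm]

-- The element `1` need not have maximal degree, so it is approached along the line `1 - s b`. For
-- `s ≠ 0` the norm there is the reverse of the minimal polynomial of `b`; at `s = 0` this gives the
-- leading coefficient `1`.
variable (K A) in
theorem reducedNorm_one : reducedNorm K (1 : A) = 1 := by
  obtain ⟨b, hb⟩ := exists_natDegree_minpoly_eq K A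
  have h : (MvPolynomial.aeval (fun i => C (coords K (1 : A) i) + C (coords K (-b) i) * X)
      (normPoly K A)) = (minpoly K b).reverse := by
    refine eq_of_eval_eq_of_ne_zero fun s hs => ?_
    rw [eval_aeval_C_add_C_mul_X, ← coords_smul, ← coords_add, ← reducedNorm_eq_eval]
    have h1 := reducedNorm_affine hb (neg_ne_zero.2 hs) 1
    rw [map_one, neg_smul, ← smul_neg] at h1
    rw [h1, neg_neg, eval_reverse hs, hb, mul_one, inv_neg, neg_neg]
  have := congrArg (eval 0) h
  rw [eval_aeval_C_add_C_mul_X, zero_smul, add_zero, ← reducedNorm_eq_eval,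
    ← coeff_zero_eq_eval_zero, coeff_zero_reverse,
    (minpoly.monic (IsIntegral.of_finite K b)).leadingCoeff] at this
  exact this

theorem normPoly_ne_zero : normPoly K A ≠ 0 := by
  intro h
  have := reducedNorm_one K A
  rw [reducedNorm_eq_eval, h, map_zero] at this
  exact zero_ne_one this

/-- Compare leading coefficients in `f(tX) = f(t) f(X)`. -/
theorem exists_pow_of_multiplicative {f : K[X]} (h1 : f.eval 1 = 1)
    (hmul : ∀ s t, f.eval (s * t) = f.eval s * f.eval t) : ∃ n : ℕ, ∀ s, f.eval s = s ^ n := by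
  have hf : f ≠ 0 := by rintro rfl; simp at h1
  refine ⟨f.natDegree, fun t => ?_⟩
  have h : f.comp (C t * X) = C (f.eval t) * f := by
    refine eq_of_eval_eq_of_ne_zero fun s _ => ?_
    simp [eval_comp, hmul]
  have := congrArg (fun p => p.coeff f.natDegree) h
  simp only [comp_C_mul_X_coeff, coeff_C_mul] at this
  have hl : f.coeff f.natDegree ≠ 0 := leadingCoeff_ne_zero.2 hf
  rw [mul_comm] at this
  exact (mul_right_cancel₀ hl this).symm

theorem exists_eq_reducedNorm_pow (hirr : Irreducible (normPoly K A)) {χ : A → K}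
    (hχ : IsCharacter χ) : ∃ t : ℕ, ∀ a : A, χ a = reducedNorm K a ^ t := by
  obtain ⟨p, hp⟩ := hχ.polynomial
  obtain ⟨n, hn⟩ : ∃ n : ℕ, ∀ s : K, χ (algebraMap K A s) = s ^ n := by
    have hs : ∀ s : K, (MvPolynomial.aeval (fun i => C ((0 : Idx K A → K) i) +
        C (coords K (1 : A) i) * X) p).eval s = χ (algebraMap K A s) := by
      intro s
      rw [eval_aeval_C_add_C_mul_X, zero_add, ← coords_smul, ← hp, Algebra.algebraMap_eq_smul_one]
    obtain ⟨n, hn⟩ := exists_pow_of_multiplicative (by rw [hs, map_one, hχ.map_one])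
      (fun s t => by rw [hs, hs, hs, map_mul, hχ.map_mul])
    exact ⟨n, fun s => by rw [← hs, hn]⟩
  -- The generic adjoint: its coordinates are polynomials, so `χ(adj a)` is polynomial in `a` and
  -- serves as the cofactor in the divisibility below.
  let adj : PolyRing K A ⊗[K] A := (-1) ^ (reducedDegree K A + 1) *
    aeval (genericElement K A) (generalCharpoly K A).divX
  have hadj : genericElement K A * adj = algebraMap _ _ (normPoly K A) :=
    exists_adjoint_of_aeval_eq_zero (aeval_genericElement K A) _
  have hdvd : p ∣ normPoly K A ^ n := by
    refine ⟨MvPolynomial.aeval (polyCoords adj) p, ?_⟩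
    refine MvPolynomial.funext fun y => ?_
    have h1 := congrArg (specialize (AlgHom.id K A) y) hadj
    rw [map_mul, specialize_genericElement, specialize_eq_sum _ _ adj,
      Algebra.TensorProduct.algebraMap_apply, specialize_tmul, map_one,
      ← Algebra.algebraMap_eq_smul_one] at h1
    have h2 := congrArg χ h1
    rw [hχ.map_mul, hn] at h2
    simp only [AlgHom.id_apply] at h2
    rw [hp, hp, coords_sum, coords_sum] at h2
    rw [map_mul, map_pow]
    refine h2.symm.trans ?_
    congr 1
    exact (map_aeval_eq_eval _ (by simp) _ _).symm
  obtain ⟨t, -, ht⟩ := (dvd_prime_pow hirr.prime n).1 hdvd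
  obtain ⟨u, hu⟩ := ht.symm
  obtain ⟨c, -, hc⟩ := MvPolynomial.isUnit_iff_eq_C_of_isReduced.1 u.isUnit
  have hχt : ∀ a : A, χ a = c * reducedNorm K a ^ t := by
    intro a
    rw [hp, ← hu, hc, map_mul, map_pow, MvPolynomial.eval_C, reducedNorm_eq_eval, mul_comm]
  have h1 := hχt 1
  rw [hχ.map_one, reducedNorm_one, one_pow, mul_one] at h1
  exact ⟨t, fun a => by rw [hχt, ← h1, one_mul]⟩

end

/-! ### Reversed polynomials and companion matrices. -/

theorem irreducible_reverse {K : Type*} [Field K] {p : K[X]} (hp : Irreducible p)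
    (h0 : p.coeff 0 ≠ 0) : Irreducible p.reverse := by
  let μ : K[X] ≃* K[X] :=
    { toFun := mirror, invFun := mirror, left_inv := mirror_mirror, right_inv := mirror_mirror,
      map_mul' := fun p q => mirror_mul_of_domain p q }
  have h : p.mirror = p.reverse := by
    rw [mirror, natTrailingDegree_eq_zero.2 (Or.inr h0), pow_zero, mul_one]
  rw [← h]
  exact (MulEquiv.irreducible_iff μ).2 hp

section

variable {K : Type*} [Field K] {D : Type*} [Ring D] [Algebra K D]

/-- The companion matrix with corner entry `v`, a `k`-th root of the scalar matrix `v`. -/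
def companion (k : ℕ) (v : D) : Matrix (Fin k) (Fin k) D := fun i j =>
  if j.val + 1 = i.val then 1 else if j.val + 1 = k ∧ i.val = 0 then v else 0

/-- The matrix shifts basis vectors cyclically and picks up a factor `v` at each wrap-around; the
quotient by `k` counts the wraps. -/
theorem companion_pow_apply (k : ℕ) (v : D) (n : ℕ) (r c : Fin k) :
    (companion k v ^ n) r c = if r.val = (n + c.val) % k then v ^ ((n + c.val) / k) else 0 := by
  have hk : 0 < k := r.pos
  induction n generalizing r with
  | zero =>
    rw [pow_zero, zero_add, Nat.mod_eq_of_lt c.2, Nat.div_eq_of_lt c.2, pow_zero, Matrix.one_apply]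
    simp [Fin.ext_iff]
  | succ n ih =>
    rw [pow_succ', Matrix.mul_apply, Finset.sum_eq_single ⟨(n + c.val) % k, Nat.mod_lt _ hk⟩]
    · rw [ih, if_pos rfl]
      set N := n + c.val with hN
      have hN' : n + 1 + c.val = N + 1 := by omega
      rw [hN', Nat.succ_div, companion]
      have hdiv := Nat.div_add_mod N k
      have hlt := Nat.mod_lt N hk
      by_cases h : N % k + 1 = k
      · have hd : k ∣ N + 1 := ⟨N / k + 1, by rw [mul_add]; omega⟩
        have hm : (N + 1) % k = 0 := Nat.mod_eq_zero_of_dvd hd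
        rw [if_pos hd, hm]
        have hr : ¬ N % k + 1 = r.val := by have := r.2; omega
        rw [if_neg hr]
        simp only [h, true_and]
        split_ifs <;> simp [pow_succ']
      · have hm : (N + 1) % k = N % k + 1 := by
          rw [Nat.add_mod, Nat.mod_eq_of_lt (a := 1) (by omega), Nat.mod_eq_of_lt (by omega)]
        have hd : ¬ k ∣ N + 1 := by
          intro hd
          have := Nat.mod_eq_zero_of_dvd hd
          omega
        rw [if_neg hd, hm]
        simp only [h, false_and, if_false, add_zero, eq_comm (a := N % k + 1)]
        split_ifs <;> simp
    · intro j _ hj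
      rw [ih, if_neg, mul_zero]
      intro h
      exact hj (Fin.ext h)
    · simp

theorem companion_smul (k : ℕ) (w : D) (s : K) :
    companion k (s • w) = companion k 0 + s • (companion k w - companion k 0) := by
  ext i j
  simp only [companion, Matrix.add_apply, Matrix.smul_apply, Matrix.sub_apply]
  split_ifs <;> simp

variable [FiniteDimensional K D]

/-- The `k`-th power is the scalar matrix `v`, so the right-hand side annihilates. It is minimal
because, in column `0`, the power of exponent `kj + r` has the single entry `v ^ j`, in row `r`: a
relation among powers splits by row into relations among powers of `v`. -/
theorem minpoly_companion {k : ℕ} (hk : 0 < k) (v : D) :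
    minpoly K (companion k v) = expand K k (minpoly K v) := by
  have hmonic := minpoly.monic (IsIntegral.of_finite K v)
  symm
  apply eq_minpoly_of_natDegree_le (hmonic.expand hk)
  · let ι : D →ₐ[K] Matrix (Fin k) (Fin k) D :=
      (Matrix.diagonalAlgHom K).comp (Pi.constAlgHom K (Fin k) D)
    have h : companion k v ^ k = ι v := by
      ext r c
      rw [companion_pow_apply, Nat.add_mod_left, Nat.mod_eq_of_lt c.2, Nat.add_div_left _ hk,
        Nat.div_eq_of_lt c.2]
      simp [ι, Matrix.diagonal_apply, Fin.ext_iff]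
    rw [expand_aeval, h, aeval_algHom_apply, minpoly.aeval, map_zero]
  · rw [natDegree_expand]
    apply le_natDegree_minpoly (IsIntegral.of_finite K _)
    rw [← linearIndependent_equiv finProdFinEquiv, Fintype.linearIndependent_iff]
    intro c hc
    have hli : LinearIndependent K fun i : Fin (minpoly K v).natDegree => v ^ (i : ℕ) :=
      linearIndependent_pow v
    rw [Fintype.linearIndependent_iff] at hli
    rintro ⟨j, r⟩
    refine hli (fun j => c (j, r)) ?_ j
    have := congrFun (congrFun hc r) ⟨0, hk⟩
    rw [Matrix.sum_apply, Fintype.sum_prod_type] at this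
    rw [Matrix.zero_apply] at this
    refine Eq.trans (Finset.sum_congr rfl fun j _ => ?_) this
    rw [Finset.sum_eq_single r]
    · simp only [Function.comp_apply, Matrix.smul_apply, companion_pow_apply,
        finProdFinEquiv_apply_val, add_zero, Nat.add_mul_mod_self_left, Nat.mod_eq_of_lt r.2,
        Nat.add_mul_div_left _ _ hk, Nat.div_eq_of_lt r.2, zero_add, if_true]
    · intro r' _ hr'
      simp only [Function.comp_apply, Matrix.smul_apply, companion_pow_apply,
        finProdFinEquiv_apply_val, add_zero, Nat.add_mul_mod_self_left, Nat.mod_eq_of_lt r'.2]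
      rw [if_neg (fun h => hr' (Fin.ext h.symm)), smul_zero]
    · simp

theorem minpoly_smul (w : D) {s : K} (hs : s ≠ 0) :
    minpoly K (s • w) = (minpoly K w).scaleRoots s := by
  symm
  apply eq_minpoly_of_natDegree_le
  · exact (monic_scaleRoots_iff s).2 (minpoly.monic (IsIntegral.of_finite K w))
  · rw [Algebra.smul_def]
    exact scaleRoots_aeval_eq_zero (minpoly.aeval K w)
  · rw [natDegree_scaleRoots]
    have := natDegree_minpoly_affine w hs 0
    rw [map_zero, zero_add] at this
    exact this.ge

end

/-! ### Irreducibility of the norm polynomial. -/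

/-- The polynomial `∑ pⱼ sʲ τ^(k(e-j))`, in the variable `s` over `K[τ]`. -/
def weightedHomogenization {K : Type*} [Field K] (p : K[X]) (k : ℕ) : K[X][X] :=
  (p.map C).scaleRoots (X ^ k)

/-- It is monic in `s`, and `τ = 1` gives back `p`; a monic polynomial with irreducible image is
irreducible. -/
theorem irreducible_weightedHomogenization {K : Type*} [Field K] {p : K[X]} (hp : p.Monic)
    (hirr : Irreducible p) (k : ℕ) : Irreducible (weightedHomogenization p k) := by
  have hm : (weightedHomogenization p k).Monic := (monic_scaleRoots_iff _).2 (hp.map _)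
  refine Monic.irreducible_of_irreducible_map (evalRingHom 1) _ hm ?_
  rw [weightedHomogenization, map_scaleRoots _ _ _ (by rw [(hp.map C).leadingCoeff]; simp),
    Polynomial.map_map]
  have : (evalRingHom (1 : K)).comp C = RingHom.id K := RingHom.ext fun x => by simp
  rw [this, Polynomial.map_id]
  simpa using hirr

theorem eval_eval_weightedHomogenization {K : Type*} [Field K] (p : K[X]) (k : ℕ) {t : K}
    (ht : t ≠ 0) (s : K) :
    ((weightedHomogenization p k).eval (C s)).eval t =
      (t ^ k) ^ p.natDegree * p.eval ((t ^ k)⁻¹ * s) := by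
  have h := scaleRoots_eval₂_mul (p := p.map C) ((evalRingHom t).comp (RingHom.id K[X]))
    ((t ^ k)⁻¹ * s) (X ^ k)
  have htk : t ^ k ≠ 0 := pow_ne_zero _ ht
  simp only [RingHom.comp_id, coe_evalRingHom, eval_pow, eval_X,
    mul_inv_cancel_left₀ htk, natDegree_map] at h
  rw [eval₂_map] at h
  have hC : (evalRingHom t).comp C = RingHom.id K := RingHom.ext fun x => by simp
  rw [hC] at h
  change _ = _ * eval₂ (RingHom.id K) _ p
  rw [← h, weightedHomogenization, ← coe_evalRingHom t, eval, hom_eval₂]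
  simp

theorem eq_of_eval_eval_eq {K : Type*} [Field K] [Infinite K] {p q : K[X][X]}
    (h : ∀ s : K, s ≠ 0 → ∀ t : K, t ≠ 0 → (p.eval (C s)).eval t = (q.eval (C s)).eval t) :
    p = q := by
  refine eq_of_infinite_eval_eq p q
    (((infinite_ne_zero K).image (C_injective (R := K)).injOn).mono ?_)
  rintro _ ⟨s, hs, rfl⟩
  exact eq_of_eval_eq_of_ne_zero (h s hs)

section

variable {K : Type*} [Field K] [Infinite K] {D : Type*} [DivisionRing D] [Algebra K D]
  [FiniteDimensional K D]

/-- The degree hypothesis says that the companion matrices of nonzero multiples of `w` have maximal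
degree, so the norm on the plane they span with `1` is explicit. The condition `w ≠ 0` gives `q` a
nonzero constant term, so reversal preserves degree and irreducibility. -/
theorem irreducible_normPoly_matrix {k : ℕ} (hk : 0 < k) {w : D} (hw : w ≠ 0)
    (hdeg : reducedDegree K (Matrix (Fin k) (Fin k) D) = k * (minpoly K w).natDegree) :
    Irreducible (normPoly K (Matrix (Fin k) (Fin k) D)) := by
  set A := Matrix (Fin k) (Fin k) D
  set q := minpoly K w with hq
  set m := reducedDegree K A with hm
  have hint := IsIntegral.of_finite K w
  have hqm : q.Monic := minpoly.monic hint
  have hqi : Irreducible q := minpoly.irreducible hint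
  have hq0 : q.coeff 0 ≠ 0 := minpoly.coeff_zero_ne_zero hint hw
  set p := q.reverse * C q.reverse.leadingCoeff⁻¹ with hp
  have hrev : Irreducible q.reverse := irreducible_reverse hqi hq0
  have hpm : p.Monic := monic_mul_leadingCoeff_inv hrev.ne_zero
  have hpi : Irreducible p := irreducible_mul_leadingCoeff_inv.2 hrev
  have hlead : q.reverse.leadingCoeff ≠ 0 := leadingCoeff_ne_zero.2 hrev.ne_zero
  have hpdeg : p.natDegree = q.natDegree := by
    rw [hp, natDegree_mul_C (inv_ne_zero hlead), reverse_natDegree,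
      natTrailingDegree_eq_zero.2 (Or.inr hq0), Nat.sub_zero]
  have hdegs : ∀ s : K, s ≠ 0 → (minpoly K (companion k (s • w))).natDegree = m := by
    intro s hs
    rw [minpoly_companion hk, natDegree_expand, minpoly_smul _ hs, natDegree_scaleRoots, mul_comm]
    exact hdeg.symm
  -- Restriction to the plane `t·1 - companion k (s • w)`; the inner variable is `t`, the outer one
  -- `s`.
  let f : PolyRing K A →ₐ[K] K[X][X] := MvPolynomial.aeval fun i =>
    C (C (coords K (1 : A) i) * X - C (coords K (companion k (0 : D)) i)) -
      C (C (coords K (companion k w - companion k (0 : D)) i)) * X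
  have hfev : ∀ (s t : K) (g : PolyRing K A), ((f g).eval (C s)).eval t =
      MvPolynomial.eval (coords K (algebraMap K A t - companion k (s • w))) g := by
    intro s t g
    have h1 := map_aeval_eq_eval (((evalRingHom t).comp (evalRingHom (C s))))
      (fun c => by simp [Polynomial.algebraMap_apply]) (fun i =>
      C (C (coords K (1 : A) i) * X - C (coords K (companion k (0 : D)) i)) -
      C (C (coords K (companion k w - companion k (0 : D)) i)) * X) g
    refine h1.trans ?_
    congr 2
    ext i
    rw [companion_smul, Algebra.algebraMap_eq_smul_one, coords_sub (_ • _), coords_smul,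
      coords_add, coords_smul]
    simp
    ring
  have hnorm : ∀ s : K, s ≠ 0 → ∀ t : K,
      ((f (normPoly K A)).eval (C s)).eval t = (minpoly K (companion k (s • w))).eval t := by
    intro s hs t
    rw [hfev, ← reducedNorm_eq_eval, reducedNorm_sub (hdegs s hs)]
  have hfN : f (normPoly K A) * C (C q.reverse.leadingCoeff⁻¹) = weightedHomogenization p k := by
    refine eq_of_eval_eval_eq fun s hs t ht => ?_
    rw [eval_mul, eval_mul, eval_C, eval_C, hnorm s hs, eval_eval_weightedHomogenization _ _ ht,
      hpdeg, hp, eval_mul, eval_C, minpoly_companion hk, expand_eval, minpoly_smul _ hs,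
      ← mul_assoc]
    congr 1
    have htk : t ^ k ≠ 0 := pow_ne_zero _ ht
    have h1 := scaleRoots_eval_mul q (s⁻¹ * t ^ k) s
    rw [mul_inv_cancel_left₀ hs] at h1
    rw [h1, eval_reverse (mul_ne_zero (inv_ne_zero htk) hs), ← mul_assoc, ← mul_pow,
      mul_inv_cancel_left₀ htk, mul_inv, inv_inv, mul_comm (t ^ k)]
  have hunit : IsUnit (C (C q.reverse.leadingCoeff⁻¹) : K[X][X]) :=
    ((isUnit_iff_ne_zero.2 (inv_ne_zero hlead)).map C).map C
  have hfirr : Irreducible (f (normPoly K A)) := by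
    rw [← irreducible_mul_isUnit hunit, hfN]
    exact irreducible_weightedHomogenization hpm hpi k
  -- On the line `s = 1` the norm has degree `m` in `t`. If `g` is constant there, `h` alone
  -- supplies this degree, so its total degree is at least `m`; nothing is left for `g`.
  have key : ∀ g h : PolyRing K A, normPoly K A = g * h → IsUnit (f g) → IsUnit g := by
    intro g h hgh hg
    have hg0 : g ≠ 0 := by rintro rfl; exact normPoly_ne_zero (hgh.trans (zero_mul _))
    have hh0 : h ≠ 0 := by rintro rfl; exact normPoly_ne_zero (hgh.trans (mul_zero _))
    have hN1 : (f (normPoly K A)).eval 1 = minpoly K (companion k ((1 : K) • w)) := by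
      refine Polynomial.funext fun t => ?_
      rw [← hnorm 1 one_ne_zero t, map_one]
    have hg1 : ((f g).eval 1).natDegree = 0 :=
      natDegree_eq_zero_of_isUnit (hg.map (evalRingHom 1))
    have hh1 : ((f h).eval 1).natDegree ≤ h.totalDegree * 1 := by
      let f1 : PolyRing K A →ₐ[K] K[X] := (aeval (1 : K[X])).restrictScalars K |>.comp f
      have : (f h).eval 1 = MvPolynomial.aeval (fun i => f1 (MvPolynomial.X i)) h := by
        refine Eq.trans ?_ (AlgHom.congr_fun (MvPolynomial.aeval_unique f1) h)
        simp [f1, coe_aeval_eq_eval]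
      rw [this]
      refine MvPolynomial.aeval_natDegree_le h le_rfl _ fun i => ?_
      simp only [f1, f, AlgHom.comp_apply, MvPolynomial.aeval_X, AlgHom.restrictScalars_apply]
      simp only [map_sub, map_mul, aeval_C, aeval_X, mul_one, Algebra.algebraMap_self,
        RingHom.id_apply]
      compute_degree
    have hprod : ((f g).eval 1 * (f h).eval 1).natDegree = m := by
      rw [← eval_mul, ← map_mul, ← hgh, hN1, hdegs 1 one_ne_zero]
    have hmul := natDegree_mul_le (p := (f g).eval 1) (q := (f h).eval 1)
    have htot := totalDegree_normPoly_le K A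
    rw [hgh, MvPolynomial.totalDegree_mul_of_isDomain hg0 hh0] at htot
    have hgt : g.totalDegree = 0 := by omega
    have hgC := MvPolynomial.totalDegree_eq_zero_iff_eq_C.1 hgt
    rw [hgC]
    refine (isUnit_iff_ne_zero.2 fun h0 => hg0 ?_).map MvPolynomial.C
    rw [hgC, h0, map_zero]
  refine ⟨fun h => hfirr.not_isUnit (h.map f), fun g h hgh => ?_⟩
  rcases hfirr.isUnit_or_isUnit (hgh ▸ map_mul f g h) with hg | hh
  · exact Or.inl (key g h hgh hg)
  · exact Or.inr (key h g (hgh.trans (mul_comm g h)) hh)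

end

/-! ### The norm from `C[X]` to `K[X]` and the degree bound in towers. -/

section

variable {K C : Type*} [Field K] [Field C] [Algebra K C] [FiniteDimensional K C]

/-- The coordinates, in `K[X]`, of a polynomial with coefficients in `C`. -/
def coordPoly (P : C[X]) (i : Idx K C) : K[X] :=
  ∑ j ∈ Finset.range (P.natDegree + 1), monomial j (coords K (P.coeff j) i)

theorem natDegree_coordPoly_le (P : C[X]) (i : Idx K C) :
    (coordPoly P i).natDegree ≤ P.natDegree :=
  natDegree_sum_le_of_forall_le _ _ fun _ hj =>
    (natDegree_monomial_le _).trans (Nat.lt_succ_iff.1 (Finset.mem_range.1 hj))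

theorem eval_coordPoly (P : C[X]) (s : K) (i : Idx K C) :
    (coordPoly P i).eval s = coords K (P.eval (algebraMap K C s)) i := by
  rw [coordPoly, eval_finsetSum, eval_eq_sum_range]
  simp only [coords, map_sum, Finsupp.coe_finsetSum, Finset.sum_apply]
  refine Finset.sum_congr rfl fun j _ => ?_
  rw [eval_monomial, ← map_pow, mul_comm (P.coeff j), ← Algebra.smul_def, map_smul,
    Finsupp.smul_apply, smul_eq_mul, mul_comm]

theorem sum_map_coordPoly (P : C[X]) :
    ∑ i, (coordPoly P i).map (algebraMap K C) * Polynomial.C (basis K C i) = P := by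
  conv_rhs => rw [as_sum_range P]
  simp only [coordPoly, Polynomial.map_sum, map_monomial, Finset.sum_mul, monomial_mul_C]
  rw [Finset.sum_comm]
  refine Finset.sum_congr rfl fun j _ => ?_
  rw [← map_sum]
  congr 1
  conv_rhs => rw [← sum_coords_smul (K := K) (P.coeff j)]
  simp only [Algebra.smul_def]

/-- The reduced norm of `C` over `K`, extended to `C[X]` over `K[X]`. -/
def polyNorm (P : C[X]) : K[X] := MvPolynomial.aeval (coordPoly P) (normPoly K C)

theorem eval_polyNorm (P : C[X]) (s : K) :
    (polyNorm P : K[X]).eval s = reducedNorm K (P.eval (algebraMap K C s)) := by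
  rw [polyNorm, ← coe_evalRingHom, map_aeval_eq_eval _ fun c => by
    rw [coe_evalRingHom, algebraMap_eq, eval_C], reducedNorm_eq_eval]
  congr 2
  ext i
  rw [coe_evalRingHom, eval_coordPoly]

/-- This is `b · adj b = n(b)` with scalars extended from `K` to `K[X]`. -/
theorem dvd_map_polyNorm (P : C[X]) : P ∣ (polyNorm P : K[X]).map (algebraMap K C) := by
  let _ : Algebra K[X] C[X] := Polynomial.algebra K C
  have htower : IsScalarTower K K[X] C[X] := IsScalarTower.of_algebraMap_eq fun x => by
    change _ = Polynomial.map _ _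
    simp [Polynomial.algebraMap_apply]
  have h := aeval_specialize (L := K[X]) (IsScalarTower.toAlgHom K C C[X]) (coordPoly P)
  have hP : ∑ i, coordPoly P i • (IsScalarTower.toAlgHom K C C[X]) (basis K C i) = P := by
    conv_rhs => rw [← sum_map_coordPoly (K := K) P]
    refine Finset.sum_congr rfl fun i _ => ?_
    rw [Algebra.smul_def]
    rfl
  rw [hP] at h
  refine ⟨_, Eq.trans ?_ (exists_adjoint_of_aeval_eq_zero h (reducedDegree K C)).symm⟩
  rw [polyNorm, normPoly, coeff_map]
  change algebraMap K[X] C[X] _ = _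
  congr 1
  rw [map_mul, map_pow, map_neg, map_one]
  rfl

/-- Up to a power of `s`, the norm of the reverse of `P` at `s` is the norm of `P` at `s⁻¹`. The
reverse takes the value `1` at `0`, and the norm of `1` is `1`. -/
theorem polyNorm_ne_zero [Infinite K] {P : C[X]} (hP : P.Monic) : (polyNorm P : K[X]) ≠ 0 := by
  intro h0
  have h1 : (polyNorm P.reverse : K[X]) = 0 := by
    refine eq_of_eval_eq_of_ne_zero fun s hs => ?_
    rw [eval_polyNorm, eval_reverse ((_root_.map_ne_zero _).2 hs), ← map_inv₀, ← map_pow,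
      ← Algebra.smul_def, reducedNorm_smul _ (pow_ne_zero _ hs), ← eval_polyNorm, h0]
    simp
  have h2 := eval_polyNorm (K := K) P.reverse 0
  rw [h1, eval_zero, map_zero, ← coeff_zero_eq_eval_zero, coeff_zero_reverse, hP.leadingCoeff,
    reducedNorm_one] at h2
  exact zero_ne_one h2

theorem natDegree_polyNorm_le [Infinite K] (P : C[X]) :
    (polyNorm P : K[X]).natDegree ≤ P.natDegree * reducedDegree K C := by
  rw [mul_comm]
  exact MvPolynomial.aeval_natDegree_le _ (totalDegree_normPoly_le K C) _
    (natDegree_coordPoly_le P)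

/-- The norm to `K[X]` of the minimal polynomial over `C` of an element of maximal degree over `K`
annihilates that element. -/
theorem reducedDegree_le_mul [Infinite K] {A : Type*} [Ring A] [Algebra K A] [Algebra C A]
    [IsScalarTower K C A] [FiniteDimensional K A] [FiniteDimensional C A] :
    reducedDegree K A ≤ reducedDegree C A * reducedDegree K C := by
  obtain ⟨a, ha⟩ := exists_natDegree_minpoly_eq K A
  have hzero : aeval a (polyNorm (minpoly C a) : K[X]) = 0 := by
    rw [← aeval_map_algebraMap C]
    obtain ⟨Q, hQ⟩ := dvd_map_polyNorm (K := K) (minpoly C a)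
    rw [hQ, map_mul, minpoly.aeval, zero_mul]
  rw [← ha]
  refine (natDegree_le_of_dvd (minpoly.dvd K a hzero)
    (polyNorm_ne_zero (minpoly.monic (IsIntegral.of_finite C a)))).trans ?_
  exact (natDegree_polyNorm_le _).trans
    (Nat.mul_le_mul_right _ (natDegree_minpoly_le a))

end

/-! ### Primitive elements with one separable generator. -/

section

open IntermediateField

/-- The primitive element theorem for two generators, the second of which is separable. -/
theorem exists_adjoin_pair_eq_adjoin_simple (F : Type*) [Field F] [Infinite F] {E : Type*}
    [Field E] [Algebra F E] (α β : E) (hα : IsIntegral F α) (hβs : IsSeparable F β) :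
    ∃ γ : E, F⟮α, β⟯ = F⟮γ⟯ := by
  have hβ := hβs.isIntegral
  let f := minpoly F α
  let g := minpoly F β
  let ιFE := algebraMap F E
  let ιEE' := algebraMap E (SplittingField (g.map ιFE))
  -- This `c` avoids finitely many ratios of differences of roots, so that `β` is the only common
  -- root of `f(γ - cX)` and `g`. Only `g` must be separable for their gcd to be linear.
  obtain ⟨c, hc⟩ := Field.primitive_element_inf_aux_exists_c (ιEE'.comp ιFE) (ιEE' α) (ιEE' β) f g
  let γ := α + c • β
  suffices β_in_Fγ : β ∈ F⟮γ⟯ by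
    use γ
    apply le_antisymm
    · rw [adjoin_le_iff]
      have α_in_Fγ : α ∈ F⟮γ⟯ := by
        rw [← add_sub_cancel_right α (c • β)]
        exact F⟮γ⟯.sub_mem (mem_adjoin_simple_self F γ) (F⟮γ⟯.toSubalgebra.smul_mem β_in_Fγ c)
      rintro x (rfl | rfl) <;> assumption
    · rw [adjoin_simple_le_iff]
      have α_in_Fαβ : α ∈ F⟮α, β⟯ := subset_adjoin F {α, β} (Set.mem_insert α {β})
      have β_in_Fαβ : β ∈ F⟮α, β⟯ := subset_adjoin F {α, β} (Set.mem_insert_of_mem α rfl)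
      exact F⟮α, β⟯.add_mem α_in_Fαβ (F⟮α, β⟯.smul_mem β_in_Fαβ)
  classical
  let p := EuclideanDomain.gcd ((f.map (algebraMap F F⟮γ⟯)).comp
    (C (AdjoinSimple.gen F γ) - (C ↑c : F⟮γ⟯[X]) * X)) (g.map (algebraMap F F⟮γ⟯))
  let h := EuclideanDomain.gcd ((f.map ιFE).comp (C γ - C (ιFE c) * X)) (g.map ιFE)
  have map_g_ne_zero : g.map ιFE ≠ 0 := Polynomial.map_ne_zero (minpoly.ne_zero hβ)
  have h_ne_zero : h ≠ 0 :=
    mt EuclideanDomain.gcd_eq_zero_iff.mp (not_and.mpr fun _ => map_g_ne_zero)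
  suffices p_linear : p.map (algebraMap F⟮γ⟯ E) = C h.leadingCoeff * (X - C β) by
    have finale : β = algebraMap F⟮γ⟯ E (-p.coeff 0 / p.coeff 1) := by
      simp [map_div₀, map_neg, ← coeff_map, ← coeff_map, p_linear,
        mul_sub, coeff_C, mul_div_cancel_left₀ β (mt leadingCoeff_eq_zero.mp h_ne_zero)]
    rw [finale]
    exact Subtype.mem (-p.coeff 0 / p.coeff 1)
  have h_sep : h.Separable := separable_gcd_right _ (.map hβs)
  have h_root : h.eval β = 0 := by
    apply eval_gcd_eq_zero
    · rw [eval_comp, eval_sub, eval_mul, eval_C, eval_C, eval_X, eval_map_algebraMap, ←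
        Algebra.smul_def, add_sub_cancel_right, minpoly.aeval]
    · rw [eval_map_algebraMap, minpoly.aeval]
  have h_splits : Splits (h.map ιEE') := by
    rw [← Polynomial.gcd_map]
    exact (SplittingField.splits _).of_dvd (Polynomial.map_ne_zero map_g_ne_zero)
      (EuclideanDomain.gcd_dvd_right _ _)
  have h_roots : ∀ x ∈ (h.map ιEE').roots, x = ιEE' β := by
    intro x hx
    rw [mem_roots_map h_ne_zero] at hx
    specialize hc (ιEE' γ - ιEE' (ιFE c) * x) (by
      have f_root := root_left_of_root_gcd hx
      rw [eval₂_comp, eval₂_sub, eval₂_mul, eval₂_C, eval₂_C, eval₂_X, eval₂_map] at f_root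
      exact (mem_roots_map (minpoly.ne_zero hα)).mpr f_root)
    specialize hc x (by
      rw [mem_roots_map (minpoly.ne_zero hβ), ← eval₂_map]
      exact root_right_of_root_gcd hx)
    by_contra a
    apply hc
    apply (div_eq_iff (sub_ne_zero.mpr a)).mpr
    simp only [γ, Algebra.smul_def, map_add, map_mul, RingHom.comp_apply]
    ring
  rw [← eq_X_sub_C_of_separable_of_root_eq h_sep h_root h_splits h_roots]
  trans EuclideanDomain.gcd (?_ : E[X]) (?_ : E[X])
  · dsimp only [γ]
    convert! (gcd_map (algebraMap F⟮γ⟯ E)).symm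
  · simp only [map_comp, Polynomial.map_map, ← IsScalarTower.algebraMap_eq, Polynomial.map_sub,
      map_C, AdjoinSimple.algebraMap_gen, Polynomial.map_mul, map_X]
    congr

theorem card_le_finrank_of_mem {K M ι : Type*} [Field K] [Field M] [Algebra K M]
    [FiniteDimensional K M] [Fintype ι] (E : IntermediateField K M) {f : ι → M}
    (hf : LinearIndependent K f) (h : ∀ i, f i ∈ E) : Fintype.card ι ≤ Module.finrank K E := by
  have hf' : LinearIndependent K fun i => (⟨f i, h i⟩ : E) :=
    LinearIndependent.of_comp E.val.toLinearMap hf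
  exact hf'.fintype_card_le_finrank

section

variable {K C M : Type*} [Field K] [Field C] [Field M] [Algebra K C] [Algebra C M] [Algebra K M]
  [IsScalarTower K C M] [FiniteDimensional K M]

/-- Some `q ^ n`-th power of `w` is separable over `K`, and since `w` is separable over `C` this
power still generates `C(w)`. -/
theorem exists_isSeparable_natDegree_minpoly_eq {w : M} (hw : IsSeparable C w) :
    ∃ v : M, IsSeparable K v ∧ (minpoly C v).natDegree = (minpoly C w).natDegree := by
  have : FiniteDimensional C M := FiniteDimensional.right K C M
  obtain ⟨q, hq⟩ := ExpChar.exists K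
  have hqC : ExpChar C q := expChar_of_injective_algebraMap (algebraMap K C).injective q
  have hqS : ExpChar (separableClosure K M) q :=
    expChar_of_injective_algebraMap (algebraMap K (separableClosure K M)).injective q
  obtain ⟨n, x, hx⟩ := (isPurelyInseparable_iff_pow_mem (separableClosure K M) (E := M) q).1
    (separableClosure.isPurelyInseparable K M) w
  refine ⟨w ^ q ^ n, ?_, ?_⟩
  · rw [← mem_separableClosure_iff, ← hx]
    exact x.2
  · rw [← adjoin.finrank (IsIntegral.of_finite C w), ← adjoin.finrank (IsIntegral.of_finite C _),
      adjoin_simple_eq_adjoin_pow_expChar_pow_of_isSeparable C M hw q n]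

theorem mul_le_finrank_adjoin_pair {z : C} {v : M} {m n : ℕ}
    (hz : LinearIndependent K fun i : Fin m => z ^ (i : ℕ))
    (hv : LinearIndependent C fun j : Fin n => v ^ (j : ℕ)) :
    m * n ≤ Module.finrank K K⟮algebraMap C M z, v⟯ := by
  have hzE : algebraMap C M z ∈ K⟮algebraMap C M z, v⟯ :=
    subset_adjoin K {algebraMap C M z, v} (Set.mem_insert _ _)
  have hvE : v ∈ K⟮algebraMap C M z, v⟯ :=
    subset_adjoin K {algebraMap C M z, v} (Set.mem_insert_of_mem _ (Set.mem_singleton v))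
  have hmem : ∀ ij : Fin m × Fin n,
      z ^ (ij.1 : ℕ) • v ^ (ij.2 : ℕ) ∈ K⟮algebraMap C M z, v⟯ := by
    intro ij
    rw [Algebra.smul_def, map_pow]
    exact mul_mem (pow_mem hzE _) (pow_mem hvE _)
  have hcard : Fintype.card (Fin m × Fin n) = m * n := by
    rw [Fintype.card_prod, Fintype.card_fin, Fintype.card_fin]
  have hli := linearIndependent_smul hz hv
  rw [← hcard]
  exact card_le_finrank_of_mem _ hli hmem

theorem exists_mul_le_natDegree_minpoly [Infinite K] {w : M} (hw : IsSeparable C w) (z : C) :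
    ∃ a : M, (minpoly C w).natDegree * (minpoly K z).natDegree ≤ (minpoly K a).natDegree := by
  obtain ⟨v, hvs, hv⟩ := exists_isSeparable_natDegree_minpoly_eq (K := K) hw
  obtain ⟨a, ha⟩ := exists_adjoin_pair_eq_adjoin_simple K (algebraMap C M z) v
    (IsIntegral.of_finite K _) hvs
  refine ⟨a, ?_⟩
  rw [← adjoin.finrank (IsIntegral.of_finite K a), ← ha, ← hv, mul_comm]
  exact mul_le_finrank_adjoin_pair (linearIndependent_pow z) (linearIndependent_pow v)

end

end

theorem exists_algHom_adjoinRoot_minpoly {C D : Type*} [Field C] [DivisionRing D] [Algebra C D]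
    (w : D) : ∃ ι : AdjoinRoot (minpoly C w) →ₐ[C] D, ι (AdjoinRoot.root _) = w := by
  refine ⟨Ideal.Quotient.liftₐ (Ideal.span {minpoly C w}) (aeval w) fun p hp => ?_, ?_⟩
  · obtain ⟨q, rfl⟩ := Ideal.mem_span_singleton.1 hp
    rw [map_mul, minpoly.aeval, zero_mul]
  · exact aeval_X w

/-- The element is found in the commutative subfield `C(w)` of `D`, modelled by `AdjoinRoot`;
embedding it in `D` preserves minimal polynomials. -/
theorem exists_mul_le_natDegree_minpoly_of_divisionRing {K C D : Type*} [Field K] [Infinite K]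
    [Field C] [DivisionRing D] [Algebra K C] [Algebra C D] [Algebra K D] [IsScalarTower K C D]
    [FiniteDimensional K C] [FiniteDimensional C D] {w : D} (hw : IsSeparable C w) (z : C) :
    ∃ a : D, (minpoly C w).natDegree * (minpoly K z).natDegree ≤ (minpoly K a).natDegree := by
  have hint : IsIntegral C w := IsIntegral.of_finite C w
  have hirr : Fact (Irreducible (minpoly C w)) := ⟨minpoly.irreducible hint⟩
  obtain ⟨ι, hι⟩ := exists_algHom_adjoinRoot_minpoly (C := C) w
  have hfin : FiniteDimensional C (AdjoinRoot (minpoly C w)) :=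
    (AdjoinRoot.powerBasis hirr.out.ne_zero).finite
  have hfinK : FiniteDimensional K (AdjoinRoot (minpoly C w)) := FiniteDimensional.trans K C _
  have hinj : Function.Injective ι := ι.toRingHom.injective
  have hroot : minpoly C (AdjoinRoot.root (minpoly C w)) = minpoly C w := by
    conv_rhs => rw [← hι, minpoly.algHom_eq ι hinj]
  obtain ⟨a, ha⟩ := exists_mul_le_natDegree_minpoly (K := K) (C := C)
    (w := AdjoinRoot.root (minpoly C w)) (by rw [IsSeparable, hroot]; exact hw) z
  refine ⟨ι a, ?_⟩
  have h2 := minpoly.algHom_eq (ι.restrictScalars K) hinj a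
  rw [AlgHom.restrictScalars_apply] at h2
  rwa [h2, ← congrArg natDegree hroot]

/-! ### Simplicity of the base change of a central division algebra. -/

section

variable {C L D : Type*} [Field C] [Field L] [Algebra C L] [DivisionRing D] [Algebra C D]

open TensorProduct in
theorem equivFinsupp_one_tmul_mul {ι : Type*} [DecidableEq ι] (b : Module.Basis ι C L) (d : D)
    (x : L ⊗[C] D) (i : ι) :
    equivFinsuppOfBasisLeft b (((1 : L) ⊗ₜ[C] d) * x) i =
      d * (equivFinsuppOfBasisLeft b x : ι →₀ D) i := by
  induction x with
  | zero => simp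
  | tmul l e => simp [Algebra.TensorProduct.tmul_mul_tmul]
  | add x y hx hy => rw [mul_add, map_add, Finsupp.add_apply, hx, hy, map_add, Finsupp.add_apply,
      mul_add]

open TensorProduct in
theorem equivFinsupp_mul_one_tmul {ι : Type*} [DecidableEq ι] (b : Module.Basis ι C L) (d : D)
    (x : L ⊗[C] D) (i : ι) :
    equivFinsuppOfBasisLeft b (x * ((1 : L) ⊗ₜ[C] d)) i =
      (equivFinsuppOfBasisLeft b x : ι →₀ D) i * d := by
  induction x with
  | zero => simp
  | tmul l e => simp [Algebra.TensorProduct.tmul_mul_tmul]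
  | add x y hx hy => rw [add_mul, map_add, Finsupp.add_apply, hx, hy, map_add, Finsupp.add_apply,
      add_mul]

-- Shortest-element argument: scale one coordinate to `1`; each commutator with `1 ⊗ d` is then
-- shorter. If all of them vanish, the coordinates are central, so the element is `l ⊗ 1` with `l ≠
-- 0`, a unit.
open TensorProduct in
theorem one_mem_of_mem_of_ne_zero [Algebra.IsCentral C D] {ι : Type*} [DecidableEq ι]
    (b : Module.Basis ι C L) (I : TwoSidedIdeal (L ⊗[C] D)) (n : ℕ) :
    ∀ x ∈ I, x ≠ 0 → (equivFinsuppOfBasisLeft b x : ι →₀ D).support.card = n → 1 ∈ I := by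
  induction n using Nat.strong_induction_on with
  | _ n ih =>
    intro x hx hx0 hn
    have hne : (equivFinsuppOfBasisLeft b x : ι →₀ D) ≠ 0 :=
      (LinearEquiv.map_ne_zero_iff _).2 hx0
    obtain ⟨i, hi⟩ := Finsupp.support_nonempty_iff.2 hne
    have hi0 := Finsupp.mem_support_iff.1 hi
    set y := ((1 : L) ⊗ₜ[C] ((equivFinsuppOfBasisLeft b x : ι →₀ D) i)⁻¹) * x with hy
    have hyI : y ∈ I := I.mul_mem_left _ _ hx
    have hyi : (equivFinsuppOfBasisLeft b y : ι →₀ D) i = 1 := by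
      rw [hy, equivFinsupp_one_tmul_mul, inv_mul_cancel₀ hi0]
    have hysupp : (equivFinsuppOfBasisLeft b y : ι →₀ D).support ⊆
        (equivFinsuppOfBasisLeft b x : ι →₀ D).support := by
      intro j hj
      rw [Finsupp.mem_support_iff, hy, equivFinsupp_one_tmul_mul] at hj
      exact Finsupp.mem_support_iff.2 (right_ne_zero_of_mul hj)
    by_cases hcomm : ∀ d : D, ((1 : L) ⊗ₜ[C] d) * y - y * ((1 : L) ⊗ₜ[C] d) = 0
    · have hcentral : ∀ j, ∃ c : C, (equivFinsuppOfBasisLeft b y : ι →₀ D) j =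
          algebraMap C D c := by
        intro j
        rw [← Algebra.IsCentral.mem_center_iff C, Subalgebra.mem_center_iff]
        intro d
        rw [← equivFinsupp_one_tmul_mul, ← equivFinsupp_mul_one_tmul, sub_eq_zero.1 (hcomm d)]
      choose c hc using hcentral
      obtain ⟨l, hl⟩ : ∃ l : L, y = l ⊗ₜ[C] 1 := by
        refine ⟨∑ j ∈ (equivFinsuppOfBasisLeft b y : ι →₀ D).support, c j • b j, ?_⟩
        conv_lhs => rw [← (equivFinsuppOfBasisLeft b).symm_apply_apply y]
        rw [equivFinsuppOfBasisLeft_symm_apply, Finsupp.sum, sum_tmul]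
        refine Finset.sum_congr rfl fun j _ => ?_
        rw [hc, smul_tmul, Algebra.algebraMap_eq_smul_one]
      have hl0 : l ≠ 0 := by
        rintro rfl
        rw [hl, zero_tmul, map_zero, Finsupp.zero_apply] at hyi
        exact zero_ne_one hyi
      have := I.mul_mem_left (l⁻¹ ⊗ₜ[C] 1) _ hyI
      rwa [hl, Algebra.TensorProduct.tmul_mul_tmul, inv_mul_cancel₀ hl0, mul_one,
        ← Algebra.TensorProduct.one_def] at this
    · push Not at hcomm
      obtain ⟨d, hd⟩ := hcomm
      refine ih _ ?_ _ (I.sub_mem (I.mul_mem_left _ _ hyI) (I.mul_mem_right _ _ hyI)) hd rfl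
      rw [← hn]
      refine Finset.card_lt_card ⟨fun j hj => hysupp ?_, fun h => ?_⟩
      · rw [Finsupp.mem_support_iff] at hj ⊢
        rintro h0
        rw [map_sub, Finsupp.sub_apply, equivFinsupp_one_tmul_mul, equivFinsupp_mul_one_tmul, h0,
          mul_zero, zero_mul, sub_zero] at hj
        exact hj rfl
      · have := Finsupp.mem_support_iff.1 (h hi)
        rw [map_sub, Finsupp.sub_apply, equivFinsupp_one_tmul_mul, equivFinsupp_mul_one_tmul, hyi,
          mul_one, one_mul, sub_self] at this
        exact this rfl

variable (C L D) in
/-- The base change of a central division algebra to a field is simple. -/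
theorem isSimpleRing_tensorProduct [Algebra.IsCentral C D] : IsSimpleRing (L ⊗[C] D) := by
  classical
  refine IsSimpleRing.of_eq_bot_or_eq_top fun I => or_iff_not_imp_left.2 fun hI => ?_
  obtain ⟨x, hx, hx0⟩ := SetLike.exists_of_lt (bot_lt_iff_ne_bot.2 hI)
  rw [← TwoSidedIdeal.one_mem_iff]
  exact one_mem_of_mem_of_ne_zero (Module.Basis.ofVectorSpace C L) I _ x hx hx0 rfl

end

/-! ### Reduced degree and separable elements through a splitting field. -/

section

variable {C L : Type*} [Field C] [Field L] [Algebra C L]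

/-- A bound for the reduced degree from annihilating polynomials after a field extension. -/
theorem reducedDegree_le_of_retraction [Infinite C] {A B : Type*} [Ring A] [Algebra C A]
    [FiniteDimensional C A] [Ring B] [Algebra C B] [Algebra L B] [IsScalarTower C L B]
    (Ψ : A →ₐ[C] B) (Θ : B →ₗ[C] A) (θ : L →ₗ[C] C) (hθ : θ 1 = 1)
    (hΘ : ∀ l a, Θ (l • Ψ a) = θ l • a) (R : ℕ)
    (hB : ∀ β : B, ∃ f : L[X], f.Monic ∧ f.natDegree ≤ R ∧ aeval β f = 0) :
    reducedDegree C A ≤ R := by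
  obtain ⟨b, hb⟩ := exists_natDegree_minpoly_eq C A
  obtain ⟨f, hf, hdeg, hzero⟩ := hB (Ψ b)
  -- Push the coefficients of `f` down to `C` by `θ`; since `θ 1 = 1`, the leading coefficient stays
  -- `1`.
  set g : C[X] := ∑ j ∈ Finset.range (f.natDegree + 1), monomial j (θ (f.coeff j)) with hg
  have hg0 : g ≠ 0 := by
    intro h
    have h1 : g.coeff f.natDegree = 1 := by
      simp [hg, coeff_monomial, hf.coeff_natDegree, hθ]
    rw [h, coeff_zero] at h1
    exact zero_ne_one h1
  have hgb : aeval b g = 0 := by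
    have h := congrArg Θ hzero
    rw [aeval_eq_sum_range, map_sum, map_zero] at h
    rw [hg, map_sum, ← h]
    refine Finset.sum_congr rfl fun j _ => ?_
    rw [aeval_monomial, ← map_pow, hΘ, Algebra.smul_def]
  have hgdeg : g.natDegree ≤ f.natDegree :=
    natDegree_sum_le_of_forall_le _ _ fun _ hj =>
      (natDegree_monomial_le _).trans (Nat.lt_succ_iff.1 (Finset.mem_range.1 hj))
  rw [← hb]
  exact (natDegree_le_of_dvd (minpoly.dvd C b hgb) hg0).trans (hgdeg.trans hdeg)

theorem exists_monic_aeval_eq_zero_of_algEquiv_matrix {B n : Type*} [Ring B] [Algebra L B]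
    [Fintype n] [DecidableEq n] (e : B ≃ₐ[L] Matrix n n L) (β : B) :
    ∃ f : L[X], f.Monic ∧ f.natDegree ≤ Fintype.card n ∧ aeval β f = 0 := by
  refine ⟨(e β).charpoly, Matrix.charpoly_monic _, (Matrix.charpoly_natDegree_eq_dim _).le, ?_⟩
  apply e.injective
  rw [map_zero, ← Matrix.aeval_self_charpoly (e β)]
  exact (aeval_algHom_apply e.toAlgHom β _).symm

theorem aeval_diagonal_apply {n : Type*} [Fintype n] [DecidableEq n] (t : n → L) (f : L[X])
    (i : n) : (aeval (Matrix.diagonal t) f) i i = f.eval (t i) := by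
  have h := aeval_algHom_apply (Matrix.diagonalAlgHom (n := n) L (α := L)) t f
  rw [Matrix.diagonalAlgHom_apply] at h
  rw [h, Matrix.diagonalAlgHom_apply, Matrix.diagonal_apply_eq]
  have h2 := aeval_algHom_apply (Pi.evalAlgHom L (fun _ : n => L) i) t f
  rw [Pi.evalAlgHom_apply, Pi.evalAlgHom_apply] at h2
  rw [← h2, coe_aeval_eq_eval]

variable {D : Type*} [DivisionRing D] [Algebra C D] [FiniteDimensional C D]

theorem reducedDegree_matrix_le_of_algEquiv [Infinite C] {r : ℕ}
    (e : L ⊗[C] D ≃ₐ[L] Matrix (Fin r) (Fin r) L) (k : ℕ) :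
    reducedDegree C (Matrix (Fin k) (Fin k) D) ≤ k * r := by
  obtain ⟨θ, hθ⟩ := LinearMap.exists_leftInverse_of_injective (Algebra.linearMap C L)
    (LinearMap.ker_eq_bot.2 (algebraMap C L).injective)
  have hθ1 : θ 1 = 1 := by simpa using LinearMap.congr_fun hθ 1
  let Θ : L ⊗[C] D →ₗ[C] D := (TensorProduct.lid C D).toLinearMap ∘ₗ LinearMap.rTensor D θ
  refine reducedDegree_le_of_retraction (L := L) (B := Matrix (Fin k) (Fin k) (L ⊗[C] D))
    (Algebra.TensorProduct.includeRight.mapMatrix) Θ.mapMatrix θ hθ1 ?_ _ fun β => ?_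
  · intro l a
    ext i j
    simp [Θ, TensorProduct.smul_tmul']
  · have h := exists_monic_aeval_eq_zero_of_algEquiv_matrix
      (e.mapMatrix.trans (Matrix.compAlgEquiv (Fin k) (Fin r) L L)) β
    simpa using h

theorem reducedDegree_le_of_algEquiv [Infinite C] {r : ℕ}
    (e : L ⊗[C] D ≃ₐ[L] Matrix (Fin r) (Fin r) L) : reducedDegree C D ≤ r := by
  obtain ⟨θ, hθ⟩ := LinearMap.exists_leftInverse_of_injective (Algebra.linearMap C L)
    (LinearMap.ker_eq_bot.2 (algebraMap C L).injective)
  have hθ1 : θ 1 = 1 := by simpa using LinearMap.congr_fun hθ 1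
  refine reducedDegree_le_of_retraction (L := L) Algebra.TensorProduct.includeRight
    ((TensorProduct.lid C D).toLinearMap ∘ₗ LinearMap.rTensor D θ) θ hθ1 ?_ _ fun β => ?_
  · intro l a
    simp [TensorProduct.smul_tmul']
  · simpa using exists_monic_aeval_eq_zero_of_algEquiv_matrix e β

/-- A diagonal matrix with distinct entries is a specialization of the generic element. All `r`
entries are roots of the specialized polynomial, whose degree is at most `r`. -/
theorem exists_map_generalCharpoly_eq_prod [Infinite C] {r : ℕ}
    (e : L ⊗[C] D ≃ₐ[L] Matrix (Fin r) (Fin r) L) {t : Fin r → L} (ht : Function.Injective t) :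
    ∃ y : Idx C D → L, (generalCharpoly C D).map
      (MvPolynomial.aeval y : PolyRing C D →ₐ[C] L).toRingHom = ∏ i, (X - Polynomial.C (t i)) := by
  let bL := Algebra.TensorProduct.basis L (basis C D)
  let x := e.symm (Matrix.diagonal t)
  let y : Idx C D → L := fun i => bL.repr x i
  refine ⟨y, ?_⟩
  have hx : ∑ i, y i • Algebra.TensorProduct.includeRight (R := C) (A := L) (basis C D i) = x := by
    conv_rhs => rw [← bL.sum_repr x]
    refine Finset.sum_congr rfl fun i _ => ?_
    simp [bL, y]
  have h := aeval_specialize (L := L) (Algebra.TensorProduct.includeRight (R := C) (A := L)) y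
  rw [hx] at h
  set f := (generalCharpoly C D).map (MvPolynomial.aeval y : PolyRing C D →ₐ[C] L).toRingHom
  have hroot : ∀ i, f.eval (t i) = 0 := by
    intro i
    have h1 := aeval_algHom_apply e.toAlgHom x f
    rw [h, map_zero] at h1
    have h2 : e.toAlgHom x = Matrix.diagonal t := e.apply_symm_apply _
    rw [h2] at h1
    rw [← aeval_diagonal_apply, h1, Matrix.zero_apply]
  have hdvd : ∏ i, (X - Polynomial.C (t i)) ∣ f :=
    Finset.prod_dvd_of_coprime
      (fun i _ j _ hij => pairwise_coprime_X_sub_C ht hij)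
      fun i _ => dvd_iff_isRoot.2 (hroot i)
  refine (eq_of_monic_of_dvd_of_natDegree_le (monic_prod_of_monic _ _ fun i _ => monic_X_sub_C _)
    ((generalCharpoly_monic C D).map _) hdvd ?_)
  rw [natDegree_map_generalCharpoly, natDegree_prod_of_monic _ _ fun i _ => monic_X_sub_C _]
  simpa using reducedDegree_le_of_algEquiv e

end

section

variable {C D : Type*} [Field C] [Infinite C] [DivisionRing D] [Algebra C D]
  [FiniteDimensional C D]

theorem reducedDegree_eq_of_algEquiv {L : Type*} [Field L] [Algebra C L] {r : ℕ}
    (e : L ⊗[C] D ≃ₐ[L] Matrix (Fin r) (Fin r) L) : reducedDegree C D = r := by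
  have hL : Infinite L := Infinite.of_injective _ (algebraMap C L).injective
  have ht : Function.Injective fun i : Fin r => Infinite.natEmbedding L i :=
    (Infinite.natEmbedding L).injective.comp Fin.val_injective
  obtain ⟨y, hy⟩ := exists_map_generalCharpoly_eq_prod e ht
  have h := congrArg natDegree hy
  rw [natDegree_map_generalCharpoly, natDegree_prod_of_monic _ _ fun i _ => monic_X_sub_C _] at h
  simpa using h

/-- Some specialization of the generic polynomial has distinct roots, so its derivative is not zero.
Hence at some `w` of maximal degree the minimal polynomial has nonzero derivative and, being
irreducible, is separable. -/
theorem exists_isSeparable_natDegree_minpoly_eq_reducedDegree {L : Type*} [Field L] [Algebra C L]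
    {r : ℕ} [NeZero r] (e : L ⊗[C] D ≃ₐ[L] Matrix (Fin r) (Fin r) L) :
    ∃ w : D, IsSeparable C w ∧ (minpoly C w).natDegree = reducedDegree C D := by
  have hL : Infinite L := Infinite.of_injective _ (algebraMap C L).injective
  have ht : Function.Injective fun i : Fin r => Infinite.natEmbedding L i :=
    (Infinite.natEmbedding L).injective.comp Fin.val_injective
  obtain ⟨y, hy⟩ := exists_map_generalCharpoly_eq_prod e ht
  have hsep := separable_prod_X_sub_C_iff.2 ht
  have hder : derivative (generalCharpoly C D) ≠ 0 := by
    intro h0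
    rw [← hy] at hsep
    rw [Separable, derivative_map, h0, Polynomial.map_zero, isCoprime_zero_right] at hsep
    have h1 := natDegree_eq_zero_of_isUnit hsep
    rw [hy, natDegree_prod_of_monic _ _ fun i _ => monic_X_sub_C _] at h1
    simp [NeZero.ne r] at h1
  obtain ⟨n, hn⟩ : ∃ n, (derivative (generalCharpoly C D)).coeff n ≠ 0 := by
    by_contra! h
    exact hder (Polynomial.ext h)
  obtain ⟨Δ, h0, hΔ⟩ := exists_polynomial_natDegree_minpoly (K := C) (A := D)
  obtain ⟨w, hw⟩ := exists_eval_coords_ne_zero (mul_ne_zero h0 hn)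
  rw [map_mul] at hw
  have hdeg := hΔ w (left_ne_zero_of_mul hw)
  refine ⟨w, ?_, hdeg⟩
  rw [IsSeparable, separable_iff_derivative_ne_zero
    (minpoly.irreducible (IsIntegral.of_finite C w)), ← reducedCharpoly_eq_minpoly hdeg]
  intro hz
  have h1 := congrArg (fun p => p.coeff n) hz
  simp only [reducedCharpoly, derivative_map, coeff_map, coeff_zero] at h1
  exact right_ne_zero_of_mul hw h1

end

/-! ### The degree of the matrix algebra. -/

section

variable {K C D : Type*} [Field K] [Infinite K] [DivisionRing D] [Algebra K D]
  [FiniteDimensional K D] [Field C] [Algebra K C] [Algebra C D] [IsScalarTower K C D]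
  [Algebra.IsCentral C D] [FiniteDimensional K C] [FiniteDimensional C D]

variable (K C D) in
theorem exists_ne_zero_and_reducedDegree_matrix_eq {k : ℕ} (hk : 0 < k) :
    ∃ w : D, w ≠ 0 ∧
      reducedDegree K (Matrix (Fin k) (Fin k) D) = k * (minpoly K w).natDegree ∧
      reducedDegree K (Matrix (Fin k) (Fin k) D) =
        reducedDegree C D * k * reducedDegree K C := by
  have hC : Infinite C := Infinite.of_injective _ (algebraMap K C).injective
  have hsimple := isSimpleRing_tensorProduct C (AlgebraicClosure C) D
  obtain ⟨r, hr, ⟨e⟩⟩ := IsSimpleRing.exists_algEquiv_matrix_of_isAlgClosed (AlgebraicClosure C)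
    (AlgebraicClosure C ⊗[C] D)
  have hrd := reducedDegree_eq_of_algEquiv e
  obtain ⟨v, hvs, hv⟩ := exists_isSeparable_natDegree_minpoly_eq_reducedDegree e
  obtain ⟨z, hz⟩ := exists_natDegree_minpoly_eq K C
  obtain ⟨a, ha⟩ := exists_mul_le_natDegree_minpoly_of_divisionRing (K := K) hvs z
  -- If `a = 0`, replace it by `1`, which has the same degree; irreducibility of the norm needs `w ≠
  -- 0`.
  obtain ⟨w, hw0, hw⟩ : ∃ w : D, w ≠ 0 ∧ (minpoly K w).natDegree = (minpoly K a).natDegree := by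
    by_cases ha0 : a = 0
    · refine ⟨1, one_ne_zero, ?_⟩
      have h := natDegree_minpoly_affine a (one_ne_zero (α := K)) 1
      rw [ha0, map_one, smul_zero, add_zero] at h
      rw [ha0, h]
    · exact ⟨a, ha0, rfl⟩
  rw [hv, hz, ← hw] at ha
  have hlower : k * (minpoly K w).natDegree ≤ reducedDegree K (Matrix (Fin k) (Fin k) D) := by
    have := natDegree_minpoly_le (K := K) (companion k w)
    rwa [minpoly_companion hk, natDegree_expand, mul_comm] at this
  have hupper : reducedDegree K (Matrix (Fin k) (Fin k) D) ≤
      k * (reducedDegree C D * reducedDegree K C) := by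
    rw [← mul_assoc, hrd]
    exact (reducedDegree_le_mul (C := C)).trans
      (Nat.mul_le_mul_right _ (reducedDegree_matrix_le_of_algEquiv e k))
  have hle := Nat.mul_le_mul_left k ha
  have h3 : reducedDegree C D * k * reducedDegree K C =
      k * (reducedDegree C D * reducedDegree K C) := by ring
  exact ⟨w, hw0, le_antisymm (hupper.trans hle) hlower,
    by rw [h3]; exact le_antisymm hupper (hle.trans hlower)⟩

end

end ReducedNorm

end

theorem theorem6p2p1 {K C D : Type*} [Field K] [Infinite K] [DivisionRing D] [Algebra K D]
    [FiniteDimensional K D]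
    -- `C` is the center of `D`, as an extension field of `K`
    [Field C] [Algebra K C] [Algebra C D] [IsScalarTower K C D] [Algebra.IsCentral C D]
    -- these two finiteness properties follow from that of `D` over `K`
    [FiniteDimensional K C] [FiniteDimensional C D]
    (d c k : ℕ) (hd : ReducedNorm.reducedDegree C D = d) (hc : ReducedNorm.reducedDegree K C = c)
    (hk : 1 ≤ k) :
    ReducedNorm.reducedDegree K (Matrix (Fin k) (Fin k) D) = d * k * c ∧
      ∀ χ : Matrix (Fin k) (Fin k) D → K, ReducedNorm.IsCharacter χ →
        ∃ t : ℕ, ∀ a : Matrix (Fin k) (Fin k) D, χ a = ReducedNorm.reducedNorm K a ^ t := by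
  obtain ⟨w, hw, h1, h2⟩ := ReducedNorm.exists_ne_zero_and_reducedDegree_matrix_eq K C D hk
  refine ⟨by rw [h2, hd, hc], fun χ hχ => ?_⟩
  exact ReducedNorm.exists_eq_reducedNorm_pow
    (ReducedNorm.irreducible_normPoly_matrix hk hw h1) hχ
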